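/- **Proposition (Subcritical compactness).** Let $n\ge 3$, let $\mathbb S^{n-1}\subset\mathbb R^n$ be the unit sphere with its normalized surface measure $\sigma$, let $p\ge 2$ and $p'=\frac{p}{p-1}$. Let $W^{1,p}(\mathbb S^{n-1};\mathbb R^n)$ be the space of maps $u\in L^p$ with a weak tangential gradient $\nabla_T u\in L^p$, and let $W^{-1,p'}(\mathbb S^{n-1};\mathbb R^n)$ be its dual. Let $(v_j)_{j\in\mathbb N}\subset W^{1,p}(\mathbb S^{n-1};\mathbb R^n)$, $(f_j)_{j\in\mathbb N}\subset L^1(\mathbb S^{n-1};\mathbb R^n)$ and $(g_j)_{j\in\mathbb N}\subset W^{-1,p'}(\mathbb S^{n-1};\mathbb R^n)$ be such that $v_j$ is a weak solution of $$\Delta_p v_j+f_j=g_j,\qquad \Delta_p v:=\operatorname{div}_{\mathbb S^{n-1}}\big(|\nabla_T v|^{p-2}\nabla_T v\big),$$ that is, for every smooth $\varphi:\mathbb S^{n-1}\to\mathbb R^n$, $$-\int_{\mathbb S^{n-1}}|\nabla_T v_j|^{p-2}\,\nabla_T v_j:\nabla_T\varphi\,d\sigma+\int_{\mathbb S^{n-1}}\langle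 f_j,\varphi\rangle\,d\sigma=g_j(\varphi).$$ Suppose that $$\sup_{j}\|v_j\|_{W^{1,p}}+\sup_j\|f_j\|_{L^1}<\infty\qquad\text{and}\qquad g_j\to0\ \text{ strongly in } W^{-1,p'}(\mathbb S^{n-1};\mathbb R^n).$$ If $v_j\rightharpoonup v$ weakly in $W^{1,p}(\mathbb S^{n-1};\mathbb R^n)$, then $v_j\to v$ strongly in $W^{1,q}(\mathbb S^{n-1};\mathbb R^n)$ for every $q$ with $1\le q<p$. -/

import Mathlib

open MeasureTheory Metric Filter Topology
open scoped ENNReal ContDiff RealInnerProductSpace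

noncomputable section

namespace SphereSobolev

/-- Euclidean space `ℝⁿ`. -/
abbrev E (n : ℕ) : Type := EuclideanSpace ℝ (Fin n)

/-- The unit sphere `𝕊ⁿ⁻¹` in `ℝⁿ`. -/
abbrev S (n : ℕ) : Type := sphere (0 : E n) 1

/-- Real `n × n` matrices with the Frobenius norm and inner product, given by their rows.
The tangential gradient of `u : 𝕊ⁿ⁻¹ → ℝⁿ` at `x` is the matrix whose `l`-th row is the tangential
gradient of the component `uˡ`, a vector of `ℝⁿ` orthogonal to `x`. -/
abbrev Mat (n : ℕ) : Type := PiLp 2 (fun _ : Fin n => E n)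

/-- The surface measure on the sphere, normalized to total mass one. -/
def σ (n : ℕ) : Measure (S n) :=
  ((volume : Measure (E n)).toSphere Set.univ)⁻¹ • (volume : Measure (E n)).toSphere

instance (n : ℕ) : IsFiniteMeasure (σ n) := by
  constructor
  simp only [σ, Measure.smul_apply, smul_eq_mul]
  exact (ENNReal.inv_mul_le_one _).trans_lt ENNReal.one_lt_top

/-- The tangential divergence at `x`, `|x| = 1`, of a vector field on `ℝⁿ`:
`∑ᵢ ⟨∂_{τᵢ} X, τᵢ⟩` over an orthonormal basis `τᵢ` of the tangent space, which is the full
divergence minus the contribution of the normal direction `x`. -/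
def sphereDiv {n : ℕ} (X : E n → E n) (x : E n) : ℝ :=
  ∑ i, (fderiv ℝ X x (EuclideanSpace.single i 1)) i - ⟪fderiv ℝ X x x, x⟫

/-- `G` is the weak tangential gradient of `u : 𝕊ⁿ⁻¹ → ℝⁿ`: its rows are tangential, and
integration by parts holds against all smooth tangential vector fields. -/
def IsWeakGradient {n : ℕ} (u : S n → E n) (G : S n → Mat n) : Prop :=
  (∀ᵐ x ∂σ n, ∀ l, ⟪G x l, (x : E n)⟫ = 0) ∧
  ∀ X : E n → E n, ContDiff ℝ ∞ X → (∀ x : S n, ⟪X x, (x : E n)⟫ = 0) →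
    ∀ l, ∫ x, u x l * sphereDiv X x ∂σ n = - ∫ x, ⟪G x l, X x⟫ ∂σ n

lemma continuous_sphereDiv {n : ℕ} {X : E n → E n} (hX : ContDiff ℝ ∞ X) :
    Continuous (fun x : S n => sphereDiv X x) := by
  have h : Continuous (fderiv ℝ X) := hX.continuous_fderiv (by simp)
  unfold sphereDiv
  fun_prop

lemma integrable_mul_div {n : ℕ} {u : S n → E n} (hu : Integrable u (σ n)) {X : E n → E n}
    (hX : ContDiff ℝ ∞ X) (l : Fin n) :
    Integrable (fun x => u x l * sphereDiv X x) (σ n) := by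
  have h1 : Integrable (fun x => u x l) (σ n) :=
    (PiLp.proj (𝕜 := ℝ) 2 (fun _ : Fin n => ℝ) l).integrable_comp hu
  have hc := continuous_sphereDiv hX
  obtain ⟨C, hC⟩ := (isCompact_univ (X := S n)).exists_bound_of_continuousOn hc.continuousOn
  exact h1.mul_bdd hc.aestronglyMeasurable (ae_of_all _ fun x => hC x trivial)

lemma integrable_inner {n : ℕ} {G : S n → Mat n} (hG : Integrable G (σ n)) {X : E n → E n}
    (hX : ContDiff ℝ ∞ X) (l : Fin n) :
    Integrable (fun x => ⟪G x l, X x⟫) (σ n) := by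
  have h1 : Integrable (fun x => G x l) (σ n) :=
    (PiLp.proj (𝕜 := ℝ) 2 (fun _ : Fin n => E n) l).integrable_comp hG
  have hc : Continuous (fun x : S n => X x) := hX.continuous.comp continuous_subtype_val
  obtain ⟨C, hC⟩ := (isCompact_univ (X := S n)).exists_bound_of_continuousOn hc.continuousOn
  refine Integrable.mono' (h1.norm.mul_const C)
    (h1.aestronglyMeasurable.inner hc.aestronglyMeasurable) (ae_of_all _ fun x => ?_)
  exact (norm_inner_le_norm _ _).trans
    (mul_le_mul_of_nonneg_left (hC x trivial) (norm_nonneg _))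

lemma IsWeakGradient.congr {n : ℕ} {u u' : S n → E n} {G G' : S n → Mat n}
    (h : IsWeakGradient u G) (hu : u' =ᵐ[σ n] u) (hG : G' =ᵐ[σ n] G) : IsWeakGradient u' G' := by
  refine ⟨?_, fun X hX hT l => ?_⟩
  · filter_upwards [h.1, hG] with x hx hx'
    rw [hx']; exact hx
  · rw [integral_congr_ae (g := fun x => u x l * sphereDiv X x)
        (by filter_upwards [hu] with x hx; rw [hx]),
      integral_congr_ae (f := fun x => ⟪G' x l, X x⟫) (g := fun x => ⟪G x l, X x⟫)
        (by filter_upwards [hG] with x hx; rw [hx])]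
    exact h.2 X hX hT l

/-- The Sobolev space `W^{1,p}(𝕊ⁿ⁻¹; ℝⁿ)`: the pairs `(u, ∇_T u)` of an `Lᵖ` map and its weak
tangential gradient, which is required to be in `Lᵖ`; the norm is
`max ‖u‖_{Lᵖ} ‖∇_T u‖_{Lᵖ}`. -/
def W (n : ℕ) (p : ℝ≥0∞) [Fact (1 ≤ p)] :
    Submodule ℝ (Lp (E n) p (σ n) × Lp (Mat n) p (σ n)) where
  carrier := {w | IsWeakGradient w.1 w.2}
  zero_mem' := by
    refine IsWeakGradient.congr (u := fun _ => 0) (G := fun _ => 0) ⟨by simp, by simp⟩ ?_ ?_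
    · exact Lp.coeFn_zero _ _ _
    · exact Lp.coeFn_zero _ _ _
  add_mem' := by
    intro a b ha hb
    have hp : (1 : ℝ≥0∞) ≤ p := Fact.out
    refine IsWeakGradient.congr (u := fun x => a.1 x + b.1 x) (G := fun x => a.2 x + b.2 x)
      ⟨?_, fun X hX hT l => ?_⟩ (Lp.coeFn_add _ _) (Lp.coeFn_add _ _)
    · filter_upwards [ha.1, hb.1] with x h1 h2 l
      simp [inner_add_left, h1 l, h2 l]
    · have h1 := ha.2 X hX hT l
      have h2 := hb.2 X hX hT l
      simp only [PiLp.add_apply, add_mul, inner_add_left]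
      rw [integral_add (integrable_mul_div ((Lp.memLp a.1).integrable hp) hX l)
          (integrable_mul_div ((Lp.memLp b.1).integrable hp) hX l),
        integral_add (integrable_inner ((Lp.memLp a.2).integrable hp) hX l)
          (integrable_inner ((Lp.memLp b.2).integrable hp) hX l), h1, h2]
      ring
  smul_mem' := by
    intro c a ha
    refine IsWeakGradient.congr (u := fun x => c • a.1 x) (G := fun x => c • a.2 x)
      ⟨?_, fun X hX hT l => ?_⟩ (Lp.coeFn_smul _ _) (Lp.coeFn_smul _ _)
    · filter_upwards [ha.1] with x h1 l
      simp [real_inner_smul_left, h1 l]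
    · have h1 := ha.2 X hX hT l
      simp only [PiLp.smul_apply, smul_eq_mul, mul_assoc, real_inner_smul_left]
      rw [integral_const_mul, integral_const_mul, h1]
      ring

/-- The map underlying an element of `W^{1,p}`. -/
def toMap {n : ℕ} {p : ℝ≥0∞} [Fact (1 ≤ p)] (w : W n p) : S n → E n := w.1.1

/-- The weak tangential gradient of an element of `W^{1,p}`. -/
def grad {n : ℕ} {p : ℝ≥0∞} [Fact (1 ≤ p)] (w : W n p) : S n → Mat n := w.1.2

/-- `W^{-1,p'}(𝕊ⁿ⁻¹; ℝⁿ)`, the dual of `W^{1,p}(𝕊ⁿ⁻¹; ℝⁿ)` with the dual norm. -/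
abbrev WDual (n : ℕ) (p : ℝ≥0∞) [Fact (1 ≤ p)] : Type := StrongDual ℝ (W n p)

/-- The element `w` of `W^{1,p}` is (the class of) a smooth map on the sphere. -/
def IsSmooth {n : ℕ} {p : ℝ≥0∞} [Fact (1 ≤ p)] (w : W n p) : Prop :=
  ∃ φ : E n → E n, ContDiff ℝ ∞ φ ∧ toMap w =ᵐ[σ n] fun x => φ x

/-- `v ∈ W^{1,p}` is a weak solution of `Δ_p v + f = g`, where
`Δ_p v = div(|∇_T v|^{p-2} ∇_T v)`, `f ∈ L¹` and `g ∈ W^{-1,p'}`: the equation holds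
when tested against smooth maps. -/
def IsWeakSolution {n : ℕ} (p : ℝ) [Fact (1 ≤ ENNReal.ofReal p)] (v : W n (ENNReal.ofReal p))
    (f : Lp (E n) 1 (σ n)) (g : WDual n (ENNReal.ofReal p)) : Prop :=
  ∀ w : W n (ENNReal.ofReal p), IsSmooth w →
    - ∫ x, ⟪‖grad v x‖ ^ (p - 2) • grad v x, grad w x⟫ ∂σ n + ∫ x, ⟪f x, toMap w x⟫ ∂σ n = g w

end SphereSobolev

end

/-! Write u_j = v_j - v. It suffices that u_j → 0 and ∇u_j → 0 in measure: both are bounded in L^p,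
and on a probability space this upgrades convergence in measure to convergence in L^q for every q <
p (`tendsto_eLpNorm_of_tendstoInMeasure`).

Gradients. Since f_j is only bounded in L¹, the equation is tested with a map that is small in the
sup norm, namely δ arctan(u_j / δ) taken componentwise. The f-term is then O(δ) uniformly in j, the
g-term tends to 0, and the gradient of the test map is ∇u_j with its rows multiplied by factors c_l
in (0, 1]. Where u_j → 0 these factors tend to 1. With the scalar weight m = ∏ c_l, strong
monotonicity of a ↦ |a|^{p-2} a for p ≥ 2 (`pFlux_monotone`, `weighted_monotone`) bounds ∫ m
|∇u_j|^p by the tested term plus terms that vanish by dominated or weak convergence. So this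
integral is eventually at most a constant times δ; as m → 1 in measure and δ is arbitrary, Markov's
inequality gives ∇u_j → 0 in measure (`tendstoInMeasure_of_weighted`, `tendstoInMeasure_grad`).

Regularization. Only smooth test maps are admitted, so Sobolev maps are averaged against the
normalized zonal kernels (1 + ⟨x, y⟩)^N. These are rotation invariant, so averaging commutes with
the infinitesimal rotations, and the latter recover the whole tangential gradient; hence averages
converge together with their gradients (`tendsto_tangGradMap_zonalConvMap`).

Compactness. The difference of two consecutive kernels is an exact tangential divergence of a field
whose L¹ norm is O(N^{-3/2}) (`zonalKer_sub_succ`, `integral_incrKer_le`). Summing over N bounds the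
L¹ error of averaging by ε_N ‖∇u‖ with ε_N → 0 (`eLpNorm_zonalConv_sub_le`). For fixed N the
averages of u_j tend to 0 by weak convergence, so u_j → 0 in L¹ (`tendsto_eLpNorm_one_of_weak`). -/

noncomputable section

namespace SphereSobolev

/-! ### Rotation invariance of the normalized surface measure -/

section Measure

instance {n : ℕ} [NeZero n] : IsProbabilityMeasure (σ n) := by
  constructor
  simp only [σ, Measure.smul_apply, smul_eq_mul]
  have : Nontrivial (E n) := by
    have : Nonempty (Fin n) := ⟨0⟩
    infer_instance
  refine ENNReal.inv_mul_cancel ?_ (measure_ne_top _ _)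
  rw [Ne, Measure.measure_univ_eq_zero]
  exact Measure.toSphere_ne_zero _

/-- The action of a linear isometry on the sphere. -/
def sphereMap {n : ℕ} (R : E n ≃ₗᵢ[ℝ] E n) (x : S n) : S n := ⟨R x, by simp⟩

-- The surface measure of a set is a multiple of the volume of the cone over it; a linear isometry
-- maps cones to cones and preserves volume.
open scoped Pointwise in
lemma measurePreserving_sphereMap {n : ℕ} (R : E n ≃ₗᵢ[ℝ] E n) :
    MeasurePreserving (sphereMap R) (σ n) (σ n) := by
  have hc : Continuous (sphereMap R) := by unfold sphereMap; fun_prop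
  have hm : Measurable (sphereMap R) := hc.measurable
  refine ⟨hm, Measure.ext fun s hs => ?_⟩
  rw [Measure.map_apply hm hs]
  simp only [σ, Measure.smul_apply, smul_eq_mul]
  rw [Measure.toSphere_apply' _ hs, Measure.toSphere_apply' _ (hm hs)]
  congr 2
  have hv : volume (R ⁻¹' (Set.Ioo (0 : ℝ) 1 • (Subtype.val '' s))) =
      volume (Set.Ioo (0 : ℝ) 1 • (Subtype.val '' s)) :=
    MeasurePreserving.measure_preimage_equiv (f := R.toMeasurableEquiv) R.measurePreserving _
  rw [← hv]
  congr 1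
  ext y
  simp only [Set.mem_smul, Set.mem_image, Set.mem_preimage]
  constructor
  · rintro ⟨r, hr, _, ⟨x, hx, rfl⟩, rfl⟩
    exact ⟨r, hr, _, ⟨_, hx, rfl⟩, by simp [sphereMap]⟩
  · rintro ⟨r, hr, _, ⟨x, hx, rfl⟩, h⟩
    refine ⟨r, hr, _, ⟨sphereMap R.symm x, ?_, rfl⟩, ?_⟩
    · have : sphereMap R (sphereMap R.symm x) = x := by ext1; simp [sphereMap]
      rwa [this]
    · apply R.injective
      have h' : r • (x : E n) = R y := h
      simp [sphereMap, h']

lemma integral_comp_isometry {n : ℕ} (R : E n ≃ₗᵢ[ℝ] E n) {φ : E n → ℝ} (hφ : Continuous φ) :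
    ∫ x : S n, φ (R x) ∂σ n = ∫ x : S n, φ x ∂σ n := by
  have h := integral_map (μ := σ n) (f := fun x : S n => φ x)
    (measurePreserving_sphereMap R).measurable.aemeasurable
    (hφ.comp continuous_subtype_val).aestronglyMeasurable
  rw [(measurePreserving_sphereMap R).map_eq] at h
  exact h.symm

/-- A continuous function on the sphere is integrable. -/
lemma integrable_of_continuous {n : ℕ} {F : Type*} [NormedAddCommGroup F]
    [SecondCountableTopology F] {φ : S n → F}
    (hφ : Continuous φ) : Integrable φ (σ n) :=
  hφ.integrable_of_hasCompactSupport (HasCompactSupport.of_compactSpace φ)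

end Measure

/-! ### Plane rotations and their generators -/

section Rotation

variable {n : ℕ}

/-- The generator `x ↦ xᵢ eⱼ - xⱼ eᵢ` of the rotations in the `(i, j)`-plane. -/
def rotGen (i j : Fin n) : E n →L[ℝ] E n :=
  (EuclideanSpace.proj i : E n →L[ℝ] ℝ).smulRight (EuclideanSpace.single j (1 : ℝ)) -
    (EuclideanSpace.proj j : E n →L[ℝ] ℝ).smulRight (EuclideanSpace.single i (1 : ℝ))

lemma rotGen_apply (i j : Fin n) (x : E n) :
    rotGen i j x = x i • EuclideanSpace.single j (1 : ℝ) - x j • EuclideanSpace.single i (1 : ℝ) :=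
  rfl

/-- The orthogonal projection onto the `(i, j)`-plane. -/
def planeProj (i j : Fin n) : E n →L[ℝ] E n :=
  (EuclideanSpace.proj i : E n →L[ℝ] ℝ).smulRight (EuclideanSpace.single i (1 : ℝ)) +
    (EuclideanSpace.proj j : E n →L[ℝ] ℝ).smulRight (EuclideanSpace.single j (1 : ℝ))

lemma planeProj_apply (i j : Fin n) (x : E n) :
    planeProj i j x =
      x i • EuclideanSpace.single i (1 : ℝ) + x j • EuclideanSpace.single j (1 : ℝ) :=
  rfl

/-- The rotation by the angle `t` in the `(i, j)`-plane. -/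
def planeRot (i j : Fin n) (t : ℝ) : E n →L[ℝ] E n :=
  ContinuousLinearMap.id ℝ (E n) + (Real.cos t - 1) • planeProj i j + Real.sin t • rotGen i j

lemma norm_planeRot {i j : Fin n} (hij : i ≠ j) (t : ℝ) (x : E n) :
    ‖planeRot i j t x‖ = ‖x‖ := by
  rw [← sq_eq_sq₀ (norm_nonneg _) (norm_nonneg _), ← real_inner_self_eq_norm_sq,
    ← real_inner_self_eq_norm_sq]
  have happ : planeRot i j t x =
      x + (Real.cos t - 1) • planeProj i j x + Real.sin t • rotGen i j x := rfl
  simp only [happ, planeProj_apply, rotGen_apply,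
    inner_add_left, inner_add_right, inner_sub_left, inner_sub_right, real_inner_smul_left,
    real_inner_smul_right, EuclideanSpace.inner_single_left, EuclideanSpace.inner_single_right]
  simp [hij, hij.symm]
  have := Real.sin_sq_add_cos_sq t
  linear_combination (x i ^ 2 + x j ^ 2) * this

/-- The rotation by the angle `t` in the `(i, j)`-plane as an isometry. -/
def planeRotIso {i j : Fin n} (hij : i ≠ j) (t : ℝ) : E n ≃ₗᵢ[ℝ] E n :=
  LinearIsometry.toLinearIsometryEquiv ⟨(planeRot i j t : E n →ₗ[ℝ] E n), norm_planeRot hij t⟩ rfl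

lemma hasDerivAt_planeRot (i j : Fin n) (t : ℝ) (x : E n) :
    HasDerivAt (fun s => planeRot i j s x)
      ((-Real.sin t) • planeProj i j x + Real.cos t • rotGen i j x) t := by
  have h1 := (((Real.hasDerivAt_cos t).sub_const 1).smul_const (planeProj i j x)).const_add x
  exact h1.add ((Real.hasDerivAt_sin t).smul_const (rotGen i j x))

/-- Infinitesimal rotation invariance of the surface measure. -/
lemma integral_fderiv_rotGen (i j : Fin n) {φ : E n → ℝ} (hφ : ContDiff ℝ 1 φ) :
    ∫ x : S n, fderiv ℝ φ x (rotGen i j x) ∂σ n = 0 := by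
  rcases eq_or_ne i j with rfl | hij
  · simp [rotGen_apply]
  have hcd : Continuous (fderiv ℝ φ) := hφ.continuous_fderiv (by simp)
  set F' : ℝ → S n → ℝ := fun t x => fderiv ℝ φ (planeRot i j t x)
    ((-Real.sin t) • planeProj i j x + Real.cos t • rotGen i j x) with hF'
  have hF'c : Continuous (fun z : ℝ × S n => F' z.1 z.2) := by
    have happ : ∀ (t : ℝ) (x : E n), planeRot i j t x =
      x + (Real.cos t - 1) • planeProj i j x + Real.sin t • rotGen i j x := fun _ _ => rfl
    simp only [hF', happ]
    fun_prop
  obtain ⟨C, hC⟩ := ((isCompact_closedBall (0 : ℝ) 1).prod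
    (isCompact_univ (X := S n))).exists_bound_of_continuousOn hF'c.continuousOn
  have hder := (hasDerivAt_integral_of_dominated_loc_of_deriv_le (μ := σ n) (x₀ := (0 : ℝ))
    (F := fun t (x : S n) => φ (planeRot i j t x)) (F' := F') (bound := fun _ => C)
    (closedBall_mem_nhds (0 : ℝ) one_pos) (Eventually.of_forall fun t => ?_) ?_ ?_ ?_
    (integrable_const C) ?_).2
  -- By invariance the integral of φ composed with the rotation by t is constant in t, so its
  -- derivative at t = 0 vanishes.
  · have hconst : (fun t => ∫ x : S n, φ (planeRot i j t x) ∂σ n) =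
        fun _ => ∫ x : S n, φ x ∂σ n :=
      funext fun t => integral_comp_isometry (planeRotIso hij t) hφ.continuous
    rw [hconst] at hder
    have := hder.unique (hasDerivAt_const _ _)
    simpa [hF', planeRot] using this
  · exact (hφ.continuous.comp ((planeRot i j t).continuous.comp
      continuous_subtype_val)).aestronglyMeasurable
  · exact integrable_of_continuous (hφ.continuous.comp ((planeRot i j 0).continuous.comp
      continuous_subtype_val))
  · exact (hF'c.comp (Continuous.prodMk_right (0 : ℝ))).aestronglyMeasurable
  · exact ae_of_all _ fun x t ht => hC (t, x) ⟨ht, trivial⟩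
  · refine ae_of_all _ fun x t _ => ?_
    exact ((hφ.differentiable (by simp)) _).hasFDerivAt.comp_hasDerivAt t
      (hasDerivAt_planeRot i j t x)

end Rotation

/-! ### Divergence theorem on the sphere, and smooth maps as Sobolev maps -/

section Divergence

variable {n : ℕ}

lemma inner_eq_sum (x y : E n) : ⟪x, y⟫ = ∑ i, x i * y i := by
  simp [PiLp.inner_apply, mul_comm]

lemma sum_mul_self_sphere (x : S n) : ∑ i, (x : E n) i * (x : E n) i = 1 := by
  rw [← inner_eq_sum, real_inner_self_eq_norm_sq]; simp

lemma fderiv_coord {X : E n → E n} {x : E n} (hX : DifferentiableAt ℝ X x) (j : Fin n) (h : E n) :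
    fderiv ℝ (fun y => X y j) x h = (fderiv ℝ X x h) j := by
  have := ((EuclideanSpace.proj j : E n →L[ℝ] ℝ).hasFDerivAt.comp x hX.hasFDerivAt).fderiv
  exact congrArg (fun L => L h) this

lemma apply_eq_sum (L : E n →L[ℝ] E n) (x : E n) (j : Fin n) :
    (L x) j = ∑ i, x i * (L (EuclideanSpace.single i 1)) j := by
  conv_lhs => rw [← (EuclideanSpace.basisFun (Fin n) ℝ).sum_repr x]
  simp [map_sum]

/-- The tangential divergence of a tangential field in terms of infinitesimal rotations. -/
lemma sphereDiv_eq_sum_rotGen {X : E n → E n} (hX : Differentiable ℝ X) {x : S n}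
    (hT : ⟪X x, (x : E n)⟫ = 0) :
    sphereDiv X x = ∑ i, ∑ j, fderiv ℝ (fun y => y i * X y j) x (rotGen i j x) := by
  have hd : ∀ i j, fderiv ℝ (fun y : E n => y i * X y j) x (rotGen i j x) =
      (if i = j then (x : E n) i * X x j else 0) - (x : E n) j * X x j +
      ((x : E n) i * (x : E n) i * (fderiv ℝ X x (EuclideanSpace.single j 1)) j -
        (x : E n) j * ((x : E n) i * (fderiv ℝ X x (EuclideanSpace.single i 1)) j)) := by
    intro i j
    have hi : DifferentiableAt ℝ (fun y : E n => y i) x :=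
      (EuclideanSpace.proj i : E n →L[ℝ] ℝ).differentiableAt
    have hj : DifferentiableAt ℝ (fun y : E n => X y j) x :=
      (EuclideanSpace.proj j : E n →L[ℝ] ℝ).differentiableAt.comp _ (hX x)
    have hi' : fderiv ℝ (fun y : E n => y i) x = (EuclideanSpace.proj i : E n →L[ℝ] ℝ) :=
      (EuclideanSpace.proj i : E n →L[ℝ] ℝ).fderiv
    rw [fderiv_fun_mul hi hj, hi']
    simp only [_root_.add_apply, _root_.smul_apply, smul_eq_mul]
    rw [fderiv_coord (hX x)]
    simp only [rotGen_apply, map_sub, map_smul]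
    by_cases hij : i = j
    · subst hij; simp; ring
    · simp [hij]; ring
  -- After summation the zeroth-order terms are multiples of ⟨X, x⟩ = 0. In the rest, |x|² = 1
  -- produces the full divergence and the mixed products produce the normal term ⟨DX x, x⟩.
  simp_rw [hd]
  rw [inner_eq_sum] at hT
  simp only [Finset.sum_add_distrib, Finset.sum_sub_distrib, Finset.sum_ite_eq, Finset.mem_univ,
    if_true]
  have h1 : ∑ i, (x : E n) i * X x i = 0 := by
    rw [← hT]; exact Finset.sum_congr rfl fun _ _ => mul_comm _ _
  rw [h1]
  simp only [Finset.sum_const_zero, sub_zero, zero_add]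
  rw [sphereDiv, inner_eq_sum]
  congr 1
  · rw [Finset.sum_comm]
    refine Finset.sum_congr rfl fun j _ => ?_
    rw [← Finset.sum_mul, sum_mul_self_sphere, one_mul]
  · rw [Finset.sum_comm]
    refine Finset.sum_congr rfl fun j _ => ?_
    rw [← Finset.mul_sum, ← apply_eq_sum, mul_comm]

/-- The divergence theorem on the sphere. -/
lemma integral_sphereDiv {X : E n → E n} (hX : ContDiff ℝ ∞ X)
    (hT : ∀ x : S n, ⟪X x, (x : E n)⟫ = 0) : ∫ x : S n, sphereDiv X x ∂σ n = 0 := by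
  have hc : ∀ i j : Fin n, ContDiff ℝ 1 (fun y : E n => y i * X y j) := fun i j => by
    have : ContDiff ℝ 1 X := hX.of_le (by simp)
    fun_prop
  simp_rw [fun x : S n => sphereDiv_eq_sum_rotGen (hX.differentiable (by simp)) (hT x)]
  have hint : ∀ i j : Fin n, Integrable
      (fun x : S n => fderiv ℝ (fun y : E n => y i * X y j) x (rotGen i j x)) (σ n) := by
    intro i j
    have h : Continuous (fderiv ℝ (fun y : E n => y i * X y j)) :=
      (hc i j).continuous_fderiv (by simp)
    exact integrable_of_continuous (by fun_prop)
  rw [integral_finsetSum _ fun i _ => integrable_finsetSum _ fun j _ => hint i j]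
  refine Finset.sum_eq_zero fun i _ => ?_
  rw [integral_finsetSum _ fun j _ => hint i j]
  exact Finset.sum_eq_zero fun j _ => integral_fderiv_rotGen i j (hc i j)

/-- The tangential gradient of a scalar function defined near the sphere. -/
def tangGrad (f : E n → ℝ) (x : E n) : E n := gradient f x - ⟪gradient f x, x⟫ • x

lemma inner_tangGrad {f : E n → ℝ} {x h : E n} (hT : ⟪h, x⟫ = 0) :
    ⟪tangGrad f x, h⟫ = fderiv ℝ f x h := by
  rw [tangGrad, inner_sub_left, real_inner_smul_left, real_inner_comm h x, hT, mul_zero, sub_zero,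
    gradient, InnerProductSpace.toDual_symm_apply]

lemma continuous_tangGrad {f : E n → ℝ} (hf : ContDiff ℝ 1 f) : Continuous (tangGrad f) := by
  have h : Continuous (fderiv ℝ f) := hf.continuous_fderiv (by simp)
  unfold tangGrad gradient
  fun_prop

/-- Leibniz rule. Tangency of X removes the normal contribution (∂_x f) ⟨X, x⟩, so no correction to
the Euclidean formula remains. -/
lemma sphereDiv_smul {f : E n → ℝ} {X : E n → E n} {x : E n} (hf : DifferentiableAt ℝ f x)
    (hX : DifferentiableAt ℝ X x) (hT : ⟪X x, x⟫ = 0) :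
    sphereDiv (fun y => f y • X y) x = f x * sphereDiv X x + fderiv ℝ f x (X x) := by
  have hL : ∑ i, fderiv ℝ f x (EuclideanSpace.single i 1) * X x i = fderiv ℝ f x (X x) := by
    conv_rhs => rw [← (EuclideanSpace.basisFun (Fin n) ℝ).sum_repr (X x)]
    simp [map_sum, mul_comm]
  rw [sphereDiv, fderiv_fun_smul hf hX, sphereDiv, ← hL]
  simp only [_root_.add_apply, _root_.smul_apply, ContinuousLinearMap.smulRight_apply,
    inner_add_left, real_inner_smul_left, hT, PiLp.add_apply, PiLp.smul_apply, smul_eq_mul,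
    Finset.sum_add_distrib, ← Finset.mul_sum, mul_zero, add_zero]
  ring

/-- The tangential gradient of a map defined near the sphere. -/
def tangGradMap (φ : E n → E n) (x : E n) : Mat n :=
  WithLp.toLp 2 fun l => tangGrad (fun y => φ y l) x

/-- The divergence theorem applied to the tangential field φˡ X, expanded by the Leibniz rule. -/
lemma isWeakGradient_of_contDiff {φ : E n → E n} (hφ : ContDiff ℝ ∞ φ) :
    IsWeakGradient (fun x : S n => φ x) (fun x => tangGradMap φ x) := by
  refine ⟨ae_of_all _ fun x l => ?_, fun X hX hT l => ?_⟩
  · have : ‖(x : E n)‖ = 1 := by simp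
    simp only [tangGradMap, tangGrad, inner_sub_left, real_inner_smul_left,
      real_inner_self_eq_norm_sq, this]
    ring
  · have hl : ContDiff ℝ ∞ (fun y => φ y l) := by fun_prop
    have h0 := integral_sphereDiv (X := fun y => φ y l • X y) (hl.smul hX)
      (fun x => by rw [real_inner_smul_left, hT, mul_zero])
    have hl' : Continuous (fderiv ℝ (fun y => φ y l)) := hl.continuous_fderiv (by simp)
    have hXc := hX.continuous
    have hφc := hφ.continuous
    have hdiv := continuous_sphereDiv hX
    simp_rw [fun x : S n => sphereDiv_smul (hl.differentiable (by simp) x)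
      (hX.differentiable (by simp) x) (hT x)] at h0
    rw [integral_add (integrable_of_continuous (by fun_prop))
      (integrable_of_continuous (by fun_prop))] at h0
    simp only [tangGradMap]
    simp_rw [fun x : S n => inner_tangGrad (f := fun y => φ y l) (hT x)]
    linarith

lemma memLp_of_continuous {F : Type*} [NormedAddCommGroup F] [SecondCountableTopology F]
    {φ : S n → F} (hφ : Continuous φ) (p : ℝ≥0∞) : MemLp φ p (σ n) := by
  obtain ⟨C, hC⟩ := (isCompact_univ (X := S n)).exists_bound_of_continuousOn hφ.continuousOn
  exact MemLp.of_bound hφ.aestronglyMeasurable C (ae_of_all _ fun x => hC x trivial)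

lemma continuous_tangGradMap {φ : E n → E n} (hφ : ContDiff ℝ ∞ φ) :
    Continuous (tangGradMap φ) := by
  have : ∀ l, Continuous (tangGrad fun y => φ y l) := fun l =>
    continuous_tangGrad (by have : ContDiff ℝ 1 φ := hφ.of_le (by simp)
                            fun_prop)
  unfold tangGradMap
  fun_prop

/-- Smooth maps belong to `W^{1,p}`. -/
lemma exists_smooth_mem_W (p : ℝ≥0∞) [Fact (1 ≤ p)] {φ : E n → E n} (hφ : ContDiff ℝ ∞ φ) :
    ∃ w : W n p, (toMap w =ᵐ[σ n] fun x => φ x) ∧ (grad w =ᵐ[σ n] fun x => tangGradMap φ x) := by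
  have h1 : MemLp (fun x : S n => φ x) p (σ n) :=
    memLp_of_continuous (hφ.continuous.comp continuous_subtype_val) p
  have h2 : MemLp (fun x : S n => tangGradMap φ x) p (σ n) :=
    memLp_of_continuous ((continuous_tangGradMap hφ).comp continuous_subtype_val) p
  exact ⟨⟨(h1.toLp _, h2.toLp _), (isWeakGradient_of_contDiff hφ).congr h1.coeFn_toLp
    h2.coeFn_toLp⟩, h1.coeFn_toLp, h2.coeFn_toLp⟩

end Divergence

/-! ### The zonal kernels and their moments -/

section Kernel

variable {n : ℕ}

lemma inner_sphere_le (x y : S n) : ⟪(x : E n), (y : E n)⟫ ≤ 1 := by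
  have := real_inner_le_norm (x : E n) y
  simpa using this

lemma neg_one_le_inner_sphere (x y : S n) : 0 ≤ 1 + ⟪(x : E n), (y : E n)⟫ := by
  have := neg_le_of_abs_le (abs_real_inner_le_norm (x : E n) y)
  simp at this
  linarith

/-- The power of a zonal function is smooth, and this is its derivative. -/
lemma hasFDerivAt_zonal (x y : E n) (m : ℕ) :
    HasFDerivAt (fun z : E n => (1 + ⟪x, z⟫) ^ m)
      ((m * (1 + ⟪x, y⟫) ^ (m - 1)) • innerSL ℝ x) y := by
  have h1 : HasFDerivAt (fun z : E n => 1 + ⟪x, z⟫) (innerSL ℝ x) y :=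
    (innerSL ℝ x).hasFDerivAt.const_add 1
  exact (h1.pow m).congr_fderiv (by simp)

lemma contDiff_zonal (x : E n) (m : ℕ) : ContDiff ℝ ∞ (fun z : E n => (1 + ⟪x, z⟫) ^ m) :=
  (contDiff_const.add (innerSL ℝ x).contDiff).pow m

/-- The tangential part `x - ⟨x, y⟩ y` of `x` at `y`. -/
def tangPart (x y : E n) : E n := x - ⟪x, y⟫ • y

lemma inner_tangPart (x y : S n) : ⟪tangPart (x : E n) y, (y : E n)⟫ = 0 := by
  simp [tangPart, inner_sub_left, real_inner_smul_left]

lemma contDiff_tangPart (x : E n) : ContDiff ℝ ∞ (tangPart x) := by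
  exact contDiff_const.sub ((innerSL ℝ x).contDiff.smul contDiff_id)

/-- The field is the tangential gradient of the linear function ⟨x, ·⟩, a spherical harmonic of
degree one; n - 1 is its eigenvalue. -/
lemma sphereDiv_tangPart (x y : S n) :
    sphereDiv (tangPart (x : E n)) y = - (n - 1) * ⟪(x : E n), (y : E n)⟫ := by
  have hd : ∀ h : E n, fderiv ℝ (tangPart (x : E n)) y h =
      -(⟪(x : E n), y⟫ • h + ⟪(x : E n), h⟫ • (y : E n)) := by
    intro h
    have h1 : HasFDerivAt (fun z : E n => ⟪(x : E n), z⟫) (innerSL ℝ (x : E n)) (y : E n) :=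
      (innerSL ℝ (x : E n)).hasFDerivAt
    have h2 := (h1.smul (hasFDerivAt_id (y : E n))).const_sub (x : E n)
    have h3 : fderiv ℝ (tangPart (x : E n)) y = _ := h2.fderiv
    rw [h3]; simp
  rw [sphereDiv]
  simp only [hd]
  have hy : ⟪(y : E n), (y : E n)⟫ = 1 := by simp
  have hxy := inner_eq_sum (x : E n) y
  simp only [PiLp.neg_apply, PiLp.add_apply, PiLp.smul_apply, smul_eq_mul, inner_neg_left,
    inner_add_left, real_inner_smul_left, hy, EuclideanSpace.inner_single_right,
    Finset.sum_neg_distrib, Finset.sum_add_distrib]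
  simp only [PiLp.single_apply, if_true]
  simp only [mul_one, one_mul, Finset.sum_const, Finset.card_univ, Fintype.card_fin, nsmul_eq_mul,
    conj_trivial, ← hxy]
  ring

/-- With t = ⟨x, y⟩, the derivative of the power contributes the factor 1 - t² = (1 + t)(2 - (1 +
t)), so only two consecutive powers of 1 + t survive. This one identity gives both the recursion for
the masses and the divergence form of the kernel increments. -/
lemma sphereDiv_zonal_tangPart (x y : S n) (m : ℕ) :
    sphereDiv (fun z => (1 + ⟪(x : E n), z⟫) ^ m • tangPart (x : E n) z) y =
      (2 * m + n - 1) * (1 + ⟪(x : E n), (y : E n)⟫) ^ m -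
        (m + n - 1) * (1 + ⟪(x : E n), (y : E n)⟫) ^ (m + 1) := by
  rw [sphereDiv_smul (hasFDerivAt_zonal _ _ _).differentiableAt
    ((contDiff_tangPart _).differentiable (by simp) _) (inner_tangPart x y),
    sphereDiv_tangPart, (hasFDerivAt_zonal _ _ _).fderiv]
  simp only [_root_.smul_apply, innerSL_apply_apply, tangPart, inner_sub_right,
    real_inner_smul_right, smul_eq_mul]
  have hx : ⟪(x : E n), (x : E n)⟫ = 1 := by simp
  rw [hx]
  rcases m with _ | m
  · simp; ring
  · simp only [Nat.add_sub_cancel]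
    push_cast
    ring

lemma inner_rotGen_self (i j : Fin n) (x : E n) : ⟪rotGen i j x, x⟫ = 0 := by
  simp [rotGen_apply, inner_sub_left, real_inner_smul_left, EuclideanSpace.inner_single_left,
    mul_comm]

lemma inner_rotGen_comm (i j : Fin n) (x y : E n) : ⟪rotGen i j x, y⟫ = -⟪x, rotGen i j y⟫ := by
  simp [rotGen_apply, inner_sub_left, inner_sub_right, real_inner_smul_left, real_inner_smul_right,
    EuclideanSpace.inner_single_left, EuclideanSpace.inner_single_right]
  ring

lemma sphereDiv_rotGen (i j : Fin n) (x : E n) : sphereDiv (rotGen i j) x = 0 := by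
  rw [sphereDiv, (rotGen i j).fderiv, inner_rotGen_self, sub_zero]
  refine Finset.sum_eq_zero fun k _ => ?_
  simp only [rotGen_apply, PiLp.single_apply, PiLp.sub_apply, PiLp.smul_apply, smul_eq_mul]
  by_cases h1 : i = k <;> by_cases h2 : j = k <;> simp [h1, h2, eq_comm]

lemma sphereDiv_zonal_rotGen (i j : Fin n) (x y : E n) (m : ℕ) :
    sphereDiv (fun z => (1 + ⟪x, z⟫) ^ m • rotGen i j z) y =
      m * (1 + ⟪x, y⟫) ^ (m - 1) * ⟪x, rotGen i j y⟫ := by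
  rw [sphereDiv_smul (hasFDerivAt_zonal _ _ _).differentiableAt
    (rotGen i j).differentiableAt (inner_rotGen_self i j y), sphereDiv_rotGen,
    (hasFDerivAt_zonal _ _ _).fderiv]
  simp

/-- The total mass of `(1 + ⟨x, y⟩) ^ N` over the sphere. -/
def zonalMass (n N : ℕ) : ℝ := ∏ k ∈ Finset.range N, ((2 * k + n - 1) / (k + n - 1) : ℝ)

lemma zonalMass_succ (n N : ℕ) :
    zonalMass n (N + 1) = zonalMass n N * ((2 * N + n - 1) / (N + n - 1)) :=
  Finset.prod_range_succ _ _

lemma one_lt_natCast [h : n.AtLeastTwo] : (1 : ℝ) < n := by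
  have : 2 ≤ n := h.prop
  exact_mod_cast this

lemma zonalMass_pos [n.AtLeastTwo] (N : ℕ) : 0 < zonalMass n N := by
  refine Finset.prod_pos fun k _ => ?_
  have := one_lt_natCast (n := n)
  have : (0 : ℝ) ≤ k := k.cast_nonneg
  exact div_pos (by linarith) (by linarith)

lemma zonalMass_le_succ [n.AtLeastTwo] (N : ℕ) : zonalMass n N ≤ zonalMass n (N + 1) := by
  rw [zonalMass_succ]
  have := one_lt_natCast (n := n)
  have : (0 : ℝ) ≤ N := N.cast_nonneg
  refine le_mul_of_one_le_right (zonalMass_pos N).le ?_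
  rw [one_le_div (by linarith)]
  linarith

lemma integrable_zonal (x : E n) (m : ℕ) :
    Integrable (fun y : S n => (1 + ⟪x, (y : E n)⟫) ^ m) (σ n) :=
  integrable_of_continuous (by fun_prop)

/-- The integral of the divergence identity `sphereDiv_zonal_tangPart` vanishes, which is the
recursion defining the product. -/
lemma integral_zonal [n.AtLeastTwo] (x : S n) (N : ℕ) :
    ∫ y : S n, (1 + ⟪(x : E n), (y : E n)⟫) ^ N ∂σ n = zonalMass n N := by
  induction N with
  | zero => simp [zonalMass]
  | succ N ih =>
    have h := integral_sphereDiv (X := fun z => (1 + ⟪(x : E n), z⟫) ^ N • tangPart (x : E n) z)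
      ((contDiff_zonal _ _).smul (contDiff_tangPart _))
      (fun y => by rw [real_inner_smul_left, inner_tangPart, mul_zero])
    simp_rw [sphereDiv_zonal_tangPart] at h
    rw [integral_sub ((integrable_zonal _ _).const_mul _) ((integrable_zonal _ _).const_mul _),
      integral_const_mul, integral_const_mul, ih] at h
    rw [zonalMass_succ]
    have := one_lt_natCast (n := n)
    have : (0 : ℝ) ≤ N := N.cast_nonneg
    have h0 : (N + n - 1 : ℝ) ≠ 0 := by linarith
    field_simp
    linarith

/-- The zonal approximate identity, proportional to `(1 + ⟨x, y⟩) ^ N`. -/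
def zonalKer (N : ℕ) (x y : E n) : ℝ := (1 + ⟪x, y⟫) ^ N / zonalMass n N

lemma zonalKer_comm (N : ℕ) (x y : E n) : zonalKer N x y = zonalKer N y x := by
  rw [zonalKer, zonalKer, real_inner_comm]

lemma zonalKer_nonneg [n.AtLeastTwo] (N : ℕ) (x y : S n) : 0 ≤ zonalKer N (x : E n) y :=
  div_nonneg (pow_nonneg (neg_one_le_inner_sphere x y) _) (zonalMass_pos N).le

lemma continuous_zonalKer (N : ℕ) : Continuous fun z : E n × E n => zonalKer N z.1 z.2 := by
  unfold zonalKer; fun_prop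

lemma continuous_zonalKer_right (N : ℕ) (x : E n) : Continuous (zonalKer N x) :=
  (continuous_zonalKer N).comp (Continuous.prodMk_right x)

lemma integral_zonalKer [n.AtLeastTwo] (N : ℕ) (x : S n) : ∫ y : S n, zonalKer N (x : E n) y ∂σ n = 1 := by
  simp only [zonalKer]
  rw [integral_div, integral_zonal, div_self (zonalMass_pos N).ne']

/-- Concentration at x: since 1 - ⟨x, y⟩ = |x - y|² / 2, the second moment of the kernel is O(1/N).
-/
lemma integral_zonalKer_mul [n.AtLeastTwo] (N : ℕ) (x : S n) :
    ∫ y : S n, zonalKer N (x : E n) y * (1 - ⟪(x : E n), (y : E n)⟫) ∂σ n =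
      (n - 1) / (N + n - 1) := by
  have h : ∀ y : S n, zonalKer N (x : E n) y * (1 - ⟪(x : E n), (y : E n)⟫) =
      (2 * (1 + ⟪(x : E n), (y : E n)⟫) ^ N - (1 + ⟪(x : E n), (y : E n)⟫) ^ (N + 1)) /
        zonalMass n N := fun y => by
    rw [zonalKer]; ring
  simp_rw [h]
  rw [integral_div, integral_sub ((integrable_zonal _ _).const_mul _) (integrable_zonal _ _),
    integral_const_mul, integral_zonal, integral_zonal, zonalMass_succ]
  have := one_lt_natCast (n := n)
  have : (0 : ℝ) ≤ N := N.cast_nonneg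
  have h0 : (N + n - 1 : ℝ) ≠ 0 := by linarith
  have := (zonalMass_pos (n := n) N).ne'
  field_simp
  ring

lemma lintegral_zonalKer [n.AtLeastTwo] (N : ℕ) (x : S n) :
    ∫⁻ y : S n, ENNReal.ofReal (zonalKer N (x : E n) y) ∂σ n = 1 := by
  rw [← ofReal_integral_eq_lintegral_ofReal (f := fun y : S n => zonalKer N (x : E n) y)
    (integrable_of_continuous ((continuous_zonalKer_right N _).comp continuous_subtype_val))
    (ae_of_all _ fun y => zonalKer_nonneg N x y), integral_zonalKer, ENNReal.ofReal_one]

end Kernel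

/-! ### Zonal averages: smoothness and commutation with rotations -/

section Convolution

variable {n : ℕ}

/-- Zonal regularization of a function on the sphere. -/
def zonalConv (N : ℕ) (f : S n → ℝ) (x : E n) : ℝ := ∫ y : S n, zonalKer N x y * f y ∂σ n

lemma integrable_continuous_mul {f : S n → ℝ} (hf : Integrable f (σ n)) {k : S n → ℝ}
    (hk : Continuous k) : Integrable (fun y => k y * f y) (σ n) := by
  obtain ⟨C, hC⟩ := (isCompact_univ (X := S n)).exists_bound_of_continuousOn hk.continuousOn
  exact hf.bdd_mul hk.aestronglyMeasurable (ae_of_all _ fun x => hC x trivial)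

lemma integrable_zonalKer_mul (N : ℕ) {f : S n → ℝ} (hf : Integrable f (σ n)) (x : E n) :
    Integrable (fun y : S n => zonalKer N x y * f y) (σ n) :=
  integrable_continuous_mul hf ((continuous_zonalKer_right N x).comp continuous_subtype_val)

/-- Expanding the N-th power separates x from y in finitely many products, so the average is a
polynomial in x on all of ℝⁿ. -/
lemma contDiff_zonalConv (N : ℕ) {f : S n → ℝ} (hf : Integrable f (σ n)) :
    ContDiff ℝ ∞ (zonalConv N f) := by
  let a : Option (Fin n) → E n → ℝ := fun o x => o.elim 1 fun i => x i
  have ha : ∀ o, ContDiff ℝ ∞ (a o) := by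
    rintro (_ | i)
    · exact contDiff_const
    · exact (EuclideanSpace.proj i : E n →L[ℝ] ℝ).contDiff
  have hexp : ∀ x y : E n, (1 + ⟪x, y⟫) ^ N =
      ∑ q : Fin N → Option (Fin n), (∏ k, a (q k) x) * ∏ k, a (q k) y := by
    intro x y
    have : 1 + ⟪x, y⟫ = ∑ o, a o x * a o y := by
      rw [Fintype.sum_option, inner_eq_sum]; simp [a]
    rw [this, Fintype.sum_pow]
    exact Finset.sum_congr rfl fun q _ => Finset.prod_mul_distrib
  have hT : zonalConv N f = fun x => (∑ q : Fin N → Option (Fin n), (∏ k, a (q k) x) *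
      ∫ y : S n, (∏ k, a (q k) (y : E n)) * f y ∂σ n) / zonalMass n N := by
    funext x
    simp only [zonalConv, zonalKer, hexp, div_mul_eq_mul_div, Finset.sum_mul]
    rw [integral_div, integral_finsetSum]
    · congr 1
      refine Finset.sum_congr rfl fun q _ => ?_
      rw [← integral_const_mul]
      simp only [mul_assoc]
    · intro q _
      simp only [mul_assoc]
      refine Integrable.const_mul (integrable_continuous_mul hf ?_) _
      exact continuous_finsetProd _ fun k _ => (ha _).continuous.comp continuous_subtype_val
  rw [hT]
  exact ContDiff.div_const (ContDiff.sum fun q _ =>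
    (contDiff_prod fun k _ => ha _).mul contDiff_const) _

/-- The derivative of the zonal kernel in its first variable. -/
lemma hasDerivAt_zonalKer (N : ℕ) (x h y : E n) (t : ℝ) :
    HasDerivAt (fun t : ℝ => zonalKer N (x + t • h) y)
      (N * (1 + ⟪x + t • h, y⟫) ^ (N - 1) * ⟪h, y⟫ / zonalMass n N) t := by
  have h1 : HasDerivAt (fun t : ℝ => 1 + ⟪x + t • h, y⟫) ⟪h, y⟫ t := by
    have : (fun t : ℝ => 1 + ⟪x + t • h, y⟫) = fun t : ℝ => 1 + (⟪x, y⟫ + t * ⟪h, y⟫) := by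
      funext t; rw [inner_add_left, real_inner_smul_left]
    rw [this]
    simpa using (((hasDerivAt_id t).mul_const ⟪h, y⟫).const_add ⟪x, y⟫).const_add 1
  simp only [zonalKer]
  exact (h1.fun_pow N).div_const _

lemma hasDerivAt_integral_mul {K K' : ℝ → S n → ℝ} (hK : ∀ t, Continuous (K t))
    (hK'c : Continuous fun z : ℝ × S n => K' z.1 z.2)
    (hKK' : ∀ t y, HasDerivAt (fun s => K s y) (K' t y) t) {f : S n → ℝ}
    (hf : Integrable f (σ n)) :
    HasDerivAt (fun t => ∫ y, K t y * f y ∂σ n) (∫ y, K' 0 y * f y ∂σ n) 0 := by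
  obtain ⟨C, hC⟩ := ((isCompact_closedBall (0 : ℝ) 1).prod
    (isCompact_univ (X := S n))).exists_bound_of_continuousOn hK'c.continuousOn
  refine (hasDerivAt_integral_of_dominated_loc_of_deriv_le (μ := σ n) (x₀ := (0 : ℝ))
    (F := fun t y => K t y * f y) (F' := fun t y => K' t y * f y)
    (bound := fun y => C * ‖f y‖) (closedBall_mem_nhds (0 : ℝ) one_pos)
    (Eventually.of_forall fun t => (integrable_continuous_mul hf (hK t)).aestronglyMeasurable)
    (integrable_continuous_mul hf (hK 0)) ?_ ?_ (hf.norm.const_mul C) ?_).2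
  · exact (integrable_continuous_mul hf
      (hK'c.comp (Continuous.prodMk_right (0 : ℝ)))).aestronglyMeasurable
  · refine ae_of_all _ fun y t ht => ?_
    rw [norm_mul]
    exact mul_le_mul_of_nonneg_right (hC (t, y) ⟨ht, trivial⟩) (norm_nonneg _)
  · exact ae_of_all _ fun y t _ => (hKK' t y).mul_const _

lemma fderiv_zonalConv (N : ℕ) {f : S n → ℝ} (hf : Integrable f (σ n)) (x h : E n) :
    fderiv ℝ (zonalConv N f) x h =
      ∫ y : S n, (N * (1 + ⟪x, (y : E n)⟫) ^ (N - 1) * ⟪h, (y : E n)⟫ / zonalMass n N) * f y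
        ∂σ n := by
  have hline : HasDerivAt (fun t : ℝ => x + t • h) h 0 := by
    simpa using ((hasDerivAt_id (0 : ℝ)).smul_const h).const_add x
  have hx : x + (0 : ℝ) • h = x := by simp
  have hd : HasDerivAt (fun t : ℝ => zonalConv N f (x + t • h))
      (fderiv ℝ (zonalConv N f) x h) 0 := by
    have hF : HasFDerivAt (zonalConv N f) (fderiv ℝ (zonalConv N f) x) (x + (0 : ℝ) • h) := by
      rw [hx]; exact ((contDiff_zonalConv N hf).differentiable (by simp) x).hasFDerivAt
    exact hF.comp_hasDerivAt (0 : ℝ) hline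
  have hder := hasDerivAt_integral_mul (K := fun t (y : S n) => zonalKer N (x + t • h) y)
    (K' := fun t (y : S n) =>
      N * (1 + ⟪x + t • h, (y : E n)⟫) ^ (N - 1) * ⟪h, (y : E n)⟫ / zonalMass n N)
    (fun t => (continuous_zonalKer_right N _).comp continuous_subtype_val) (by fun_prop)
    (fun t y => hasDerivAt_zonalKer N x h y t) hf
  simp only [hx] at hder
  exact hd.unique hder

/-- Zonal regularization commutes with infinitesimal rotations. -/
lemma fderiv_zonalConv_rotGen (N : ℕ) {u : S n → E n} {G : S n → Mat n}
    (hu : Integrable u (σ n)) (h : IsWeakGradient u G) (l i j : Fin n) (x : E n) :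
    fderiv ℝ (zonalConv N fun y => u y l) x (rotGen i j x) =
      zonalConv N (fun y => ⟪G y l, rotGen i j y⟫) x := by
  have hul : Integrable (fun y => u y l) (σ n) :=
    (PiLp.proj (𝕜 := ℝ) 2 (fun _ : Fin n => ℝ) l).integrable_comp hu
  -- The generator is divergence free, so only the derivative of the weight appears; its
  -- antisymmetry then moves the rotation from x to y.
  have hw := h.2 (fun z => (1 + ⟪x, z⟫) ^ N • rotGen i j z)
    ((contDiff_zonal _ _).smul (rotGen i j).contDiff)
    (fun y => by rw [real_inner_smul_left, inner_rotGen_self, mul_zero]) l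
  rw [fderiv_zonalConv N hul, zonalConv]
  simp_rw [sphereDiv_zonal_rotGen, real_inner_smul_right] at hw
  simp_rw [inner_rotGen_comm, zonalKer, div_mul_eq_mul_div, integral_div]
  congr 1
  rw [← neg_inj, ← hw, ← integral_neg]
  congr 1
  funext y
  ring

/-- On |x| = 1, ∑ᵢ xᵢ (xᵢ ∂ⱼ - xⱼ ∂ᵢ) = ∂ⱼ - xⱼ ∂ₓ: the rotational derivatives determine the
tangential gradient. -/
lemma tangGrad_apply (f : E n → ℝ) (x : S n) (j : Fin n) :
    tangGrad f x j = ∑ i, (x : E n) i * fderiv ℝ f x (rotGen i j x) := by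
  have hg : ∀ k, gradient f (x : E n) k = fderiv ℝ f x (EuclideanSpace.single k 1) := by
    intro k
    have h1 : ⟪gradient f (x : E n), EuclideanSpace.single k (1 : ℝ)⟫ =
        fderiv ℝ f x (EuclideanSpace.single k 1) := by
      rw [gradient, InnerProductSpace.toDual_symm_apply]
    rw [← h1, EuclideanSpace.inner_single_right]
    simp
  simp only [tangGrad, PiLp.sub_apply, PiLp.smul_apply, smul_eq_mul, inner_eq_sum, hg,
    rotGen_apply, map_sub, map_smul, mul_sub, Finset.sum_sub_distrib]
  congr 1
  · simp_rw [← mul_assoc]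
    rw [← Finset.sum_mul, sum_mul_self_sphere, one_mul]
  · rw [Finset.sum_mul]
    exact Finset.sum_congr rfl fun i _ => by ring

end Convolution

/-! ### Convergence of zonal averages -/

section Approximation

variable {n : ℕ}

/-- Jensen's inequality for the probability measure with density the kernel at x, in the form that
Lebesgue norms increase with the exponent on a probability space. -/
lemma zonalConv_enorm_rpow_le [n.AtLeastTwo] (N : ℕ) {f : S n → ℝ}
    (hf : AEStronglyMeasurable f (σ n)) {p : ℝ≥0∞} (hp1 : 1 ≤ p) (hp : p ≠ ⊤) (x : S n) :
    ‖zonalConv N f x‖ₑ ^ p.toReal ≤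
      ∫⁻ y : S n, ENNReal.ofReal (zonalKer N (x : E n) y) * ‖f y‖ₑ ^ p.toReal ∂σ n := by
  have hp0 : p ≠ 0 := (zero_lt_one.trans_le hp1).ne'
  have hpos : 0 < p.toReal := ENNReal.toReal_pos hp0 hp
  set κ : S n → ℝ≥0∞ := fun y => ENNReal.ofReal (zonalKer N (x : E n) y) with hκ
  have hκm : AEMeasurable κ (σ n) := by
    have : Continuous fun y : S n => zonalKer N (x : E n) y :=
      (continuous_zonalKer_right N _).comp continuous_subtype_val
    exact this.measurable.ennreal_ofReal.aemeasurable
  set ν := (σ n).withDensity κ with hν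
  have : IsProbabilityMeasure ν := ⟨by
    rw [hν, withDensity_apply _ MeasurableSet.univ, Measure.restrict_univ]
    exact lintegral_zonalKer N x⟩
  have hfν : AEStronglyMeasurable f ν := hf.mono_ac (withDensity_absolutelyContinuous _ _)
  have h1 : ‖zonalConv N f x‖ₑ ≤ eLpNorm f 1 ν := by
    refine (enorm_integral_le_lintegral_enorm _).trans ?_
    rw [eLpNorm_one_eq_lintegral_enorm, hν,
      lintegral_withDensity_eq_lintegral_mul₀ hκm hf.enorm]
    refine lintegral_mono fun y => ?_
    simp only [enorm_mul, Pi.mul_apply, hκ]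
    rw [Real.enorm_of_nonneg (zonalKer_nonneg N x y)]
  have h2 := h1.trans (eLpNorm_le_eLpNorm_of_exponent_le hp1 hfν)
  refine (ENNReal.rpow_le_rpow h2 hpos.le).trans ?_
  rw [eLpNorm_eq_lintegral_rpow_enorm_toReal hp0 hp, ← ENNReal.rpow_mul,
    one_div_mul_cancel hpos.ne', ENNReal.rpow_one, hν,
    lintegral_withDensity_eq_lintegral_mul₀ hκm (hf.enorm.pow_const _)]
  rfl

lemma lintegral_kernel_swap {k : S n × S n → ℝ} (hk : Continuous k) {h : S n → ℝ≥0∞}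
    (hh : AEMeasurable h (σ n)) :
    ∫⁻ x, ∫⁻ y, ENNReal.ofReal (k (x, y)) * h y ∂σ n ∂σ n =
      ∫⁻ y, (∫⁻ x, ENNReal.ofReal (k (x, y)) ∂σ n) * h y ∂σ n := by
  have hm : AEMeasurable (fun z : S n × S n => ENNReal.ofReal (k z) * h z.2)
      ((σ n).prod (σ n)) :=
    hk.measurable.ennreal_ofReal.aemeasurable.mul hh.comp_snd
  rw [lintegral_lintegral_swap hm]
  refine lintegral_congr fun y => ?_
  have hky : Continuous fun x => k (x, y) := by fun_prop
  exact lintegral_mul_const'' _ hky.measurable.ennreal_ofReal.aemeasurable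

/-- Zonal regularization is a contraction of `Lᵖ`. -/
lemma eLpNorm_zonalConv_le [n.AtLeastTwo] (N : ℕ) {f : S n → ℝ}
    (hf : AEStronglyMeasurable f (σ n)) {p : ℝ≥0∞} (hp1 : 1 ≤ p) (hp : p ≠ ⊤) :
    eLpNorm (fun x : S n => zonalConv N f x) p (σ n) ≤ eLpNorm f p (σ n) := by
  have hp0 : p ≠ 0 := (zero_lt_one.trans_le hp1).ne'
  rw [eLpNorm_eq_lintegral_rpow_enorm_toReal hp0 hp, eLpNorm_eq_lintegral_rpow_enorm_toReal hp0 hp]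
  refine ENNReal.rpow_le_rpow ?_ (by positivity)
  refine (lintegral_mono fun x => zonalConv_enorm_rpow_le N hf hp1 hp x).trans ?_
  have hk : Continuous fun z : S n × S n => zonalKer N (z.1 : E n) z.2 :=
    (continuous_zonalKer N).comp (Continuous.prodMap continuous_subtype_val continuous_subtype_val)
  have hone : ∀ y : S n, ∫⁻ x : S n, ENNReal.ofReal (zonalKer N (x : E n) y) ∂σ n = 1 := fun y => by
    rw [← lintegral_zonalKer N y]
    exact lintegral_congr fun x => by rw [zonalKer_comm]
  have hswap := lintegral_kernel_swap hk (hf.enorm.pow_const p.toReal)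
  simp only [hone, one_mul] at hswap
  exact hswap.le

lemma norm_sub_sq_sphere (x y : S n) :
    ‖(x : E n) - y‖ ^ 2 = 2 * (1 - ⟪(x : E n), (y : E n)⟫) := by
  rw [norm_sub_sq_real]
  simp
  ring

/-- Zonal regularizations of a continuous function converge uniformly. -/
lemma zonalConv_uniform [n.AtLeastTwo] {g : S n → ℝ} (hg : Continuous g) {ε : ℝ} (hε : 0 < ε) :
    ∀ᶠ N in atTop, ∀ x : S n, |zonalConv N g x - g x| ≤ ε := by
  obtain ⟨M, hM⟩ := (isCompact_univ (X := S n)).exists_bound_of_continuousOn hg.continuousOn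
  obtain ⟨δ, hδ, hgδ⟩ := Metric.uniformContinuous_iff.1
    (CompactSpace.uniformContinuous_of_continuous hg) (ε / 2) (by linarith)
  have hM0 : 0 ≤ M := by
    obtain ⟨x⟩ := nonempty_of_isProbabilityMeasure (σ n)
    exact (norm_nonneg _).trans (hM x trivial)
  -- Chosen so that A |x - y|² ≥ 2M at distance at least δ; the oscillation of g is then bounded by
  -- ε/2 plus a multiple of the second moment, which tends to 0.
  set A : ℝ := 2 * M / δ ^ 2 with hA
  have hA0 : 0 ≤ A := by positivity
  have hpt : ∀ x y : S n, |g y - g x| ≤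
      ε / 2 + A * (2 * (1 - ⟪(x : E n), (y : E n)⟫)) := by
    intro x y
    rw [← norm_sub_sq_sphere]
    rcases lt_or_ge (dist y x) δ with h | h
    · have := hgδ h
      rw [Real.dist_eq] at this
      have : 0 ≤ A * ‖(x : E n) - y‖ ^ 2 := by positivity
      linarith
    · have h1 : δ ≤ ‖(x : E n) - y‖ := by
        rw [← dist_eq_norm, dist_comm]; exact h
      have h2 : δ ^ 2 ≤ ‖(x : E n) - y‖ ^ 2 := by gcongr
      have h3 : |g y - g x| ≤ 2 * M := by
        have a := abs_sub (g y) (g x)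
        have b := hM x trivial
        have c := hM y trivial
        rw [Real.norm_eq_abs] at b c
        linarith
      have h4 : 2 * M ≤ A * ‖(x : E n) - y‖ ^ 2 := by
        calc 2 * M = A * δ ^ 2 := by rw [hA]; field_simp
          _ ≤ _ := by gcongr
      linarith
  have hlim : Tendsto (fun N : ℕ => A * (2 * ((n - 1 : ℝ) / (N + n - 1)))) atTop (𝓝 0) := by
    have h1 : Tendsto (fun N : ℕ => (N + n - 1 : ℝ)) atTop atTop := by
      have := tendsto_natCast_atTop_atTop (R := ℝ)
      simpa [add_sub_assoc] using tendsto_atTop_add_const_right atTop ((n : ℝ) - 1) this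
    have := ((h1.const_div_atTop (n - 1 : ℝ)).const_mul 2).const_mul A
    simpa using this
  filter_upwards [hlim.eventually (gt_mem_nhds (show (0 : ℝ) < ε / 2 by linarith))] with N hN x
  have hgi := integrable_of_continuous hg
  have hKc : Continuous fun y : S n => zonalKer N (x : E n) y :=
    (continuous_zonalKer_right N _).comp continuous_subtype_val
  have e1 : zonalConv N g x - g x = ∫ y : S n, zonalKer N (x : E n) y * (g y - g x) ∂σ n := by
    simp_rw [mul_sub]
    rw [integral_sub (integrable_zonalKer_mul N hgi x)
      (integrable_of_continuous (by fun_prop)), integral_mul_const, integral_zonalKer, one_mul]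
    rfl
  rw [e1]
  have hi : Integrable (fun y : S n => zonalKer N (x : E n) y * (ε / 2) +
      2 * A * (zonalKer N (x : E n) y * (1 - ⟪(x : E n), (y : E n)⟫))) (σ n) :=
    integrable_of_continuous (by fun_prop)
  have := norm_integral_le_of_norm_le hi (ae_of_all _ fun y => show
      ‖zonalKer N (x : E n) y * (g y - g x)‖ ≤ _ from ?_)
  · rw [integral_add (integrable_of_continuous (by fun_prop))
      (integrable_of_continuous (by fun_prop)), integral_mul_const, integral_const_mul,
      integral_zonalKer, integral_zonalKer_mul] at this
    rw [← Real.norm_eq_abs]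
    linarith
  · rw [norm_mul, Real.norm_of_nonneg (zonalKer_nonneg N x y), Real.norm_eq_abs]
    have := mul_le_mul_of_nonneg_left (hpt x y) (zonalKer_nonneg N x y)
    linarith

lemma zonalConv_sub (N : ℕ) {f g : S n → ℝ} (hf : Integrable f (σ n)) (hg : Integrable g (σ n))
    (x : E n) : zonalConv N (fun y => f y - g y) x = zonalConv N f x - zonalConv N g x := by
  simp only [zonalConv, mul_sub]
  exact integral_sub (integrable_zonalKer_mul N hf x) (integrable_zonalKer_mul N hg x)

lemma continuous_zonalConv_sphere (N : ℕ) {f : S n → ℝ} (hf : Integrable f (σ n)) :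
    Continuous fun x : S n => zonalConv N f x :=
  (contDiff_zonalConv N hf).continuous.comp continuous_subtype_val

/-- Zonal regularizations converge in `Lᵖ`. -/
lemma tendsto_zonalConv [n.AtLeastTwo] {p : ℝ≥0∞} (hp1 : 1 ≤ p) (hp : p ≠ ⊤) {f : S n → ℝ}
    (hf : MemLp f p (σ n)) :
    Tendsto (fun N => eLpNorm (fun x : S n => zonalConv N f x - f x) p (σ n)) atTop (𝓝 0) := by
  rw [ENNReal.tendsto_nhds_zero]
  intro ε hε
  have hε3 : ε / 3 ≠ 0 := (ENNReal.div_pos hε.ne' (by simp)).ne'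
  obtain ⟨g, hfg, hg⟩ := hf.exists_boundedContinuous_eLpNorm_sub_le hp hε3
  -- Capping at 1 keeps the tolerance finite when ε = ⊤.
  set δ : ℝ≥0∞ := min (ε / 3) 1 with hδ
  have hδtop : δ ≠ ⊤ := (min_le_right _ _).trans_lt ENNReal.one_lt_top |>.ne
  have hδ0 : δ ≠ 0 := (lt_min (pos_iff_ne_zero.2 hε3) one_pos).ne'
  have hfi := hf.integrable hp1
  have hgi := integrable_of_continuous (n := n) g.continuous
  filter_upwards [zonalConv_uniform g.continuous (ENNReal.toReal_pos hδ0 hδtop)] with N hN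
  have hTfg : Continuous fun x : S n => zonalConv N (fun y => f y - g y) x :=
    continuous_zonalConv_sphere N (hfi.sub hgi)
  have hTg : Continuous fun x : S n => zonalConv N g x := continuous_zonalConv_sphere N hgi
  have h1 : eLpNorm (fun x : S n => zonalConv N (fun y => f y - g y) x) p (σ n) ≤ ε / 3 :=
    (eLpNorm_zonalConv_le N (hfi.sub hgi).aestronglyMeasurable hp1 hp).trans hfg
  have h2 : eLpNorm (fun x : S n => zonalConv N g x - g x) p (σ n) ≤ ε / 3 := by
    refine (eLpNorm_le_of_ae_bound (ae_of_all _ hN)).trans ?_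
    rw [measure_univ, ENNReal.one_rpow, one_mul, ENNReal.ofReal_toReal hδtop]
    exact min_le_left _ _
  have h3 : eLpNorm (fun x : S n => g x - f x) p (σ n) ≤ ε / 3 := by
    have := eLpNorm_sub_comm (⇑g) f p (σ n)
    exact this.le.trans hfg
  have hdec : (fun x : S n => zonalConv N f x - f x) =
      ((fun x : S n => zonalConv N (fun y => f y - g y) x) +
        (fun x : S n => zonalConv N g x - g x)) + fun x : S n => g x - f x := by
    funext x
    simp only [Pi.add_apply, zonalConv_sub N hfi hgi]
    ring
  have m1 : AEStronglyMeasurable (fun x : S n => zonalConv N g x - g x) (σ n) :=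
    (hTg.sub g.continuous).aestronglyMeasurable
  rw [hdec]
  refine (eLpNorm_add_le (hTfg.aestronglyMeasurable.add m1)
    (g.continuous.aestronglyMeasurable.sub hf.1) hp1).trans ?_
  refine (add_le_add ((eLpNorm_add_le hTfg.aestronglyMeasurable m1 hp1).trans
    (add_le_add h1 h2)) h3).trans ?_
  rw [ENNReal.add_thirds]

end Approximation

/-! ### Averages of maps and convergence of their gradients -/

section Vector

variable {n : ℕ}

/-- Componentwise zonal regularization. -/
def zonalConvMap (N : ℕ) (u : S n → E n) (x : E n) : E n :=
  WithLp.toLp 2 fun l => zonalConv N (fun y => u y l) x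

lemma integrable_coord {u : S n → E n} (hu : Integrable u (σ n)) (l : Fin n) :
    Integrable (fun y => u y l) (σ n) :=
  (PiLp.proj (𝕜 := ℝ) 2 (fun _ : Fin n => ℝ) l).integrable_comp hu

lemma memLp_coord {u : S n → E n} {p : ℝ≥0∞} (hu : MemLp u p (σ n)) (l : Fin n) :
    MemLp (fun y => u y l) p (σ n) :=
  (PiLp.proj (𝕜 := ℝ) 2 (fun _ : Fin n => ℝ) l).comp_memLp' hu

lemma memLp_row {G : S n → Mat n} {p : ℝ≥0∞} (hG : MemLp G p (σ n)) (l : Fin n) :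
    MemLp (fun y => G y l) p (σ n) :=
  (PiLp.proj (𝕜 := ℝ) 2 (fun _ : Fin n => E n) l).comp_memLp' hG

lemma contDiff_zonalConvMap (N : ℕ) {u : S n → E n} (hu : Integrable u (σ n)) :
    ContDiff ℝ ∞ (zonalConvMap N u) := by
  rw [contDiff_piLp]
  exact fun l => contDiff_zonalConv N (integrable_coord hu l)

lemma norm_le_sum_norm {F : Type*} [NormedAddCommGroup F] (x : PiLp 2 (fun _ : Fin n => F)) :
    ‖x‖ ≤ ∑ l, ‖x l‖ := by
  refine abs_le_of_sq_le_sq' ?_ (Finset.sum_nonneg fun _ _ => norm_nonneg _) |>.2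
  rw [PiLp.norm_sq_eq_of_L2]
  exact Finset.sum_sq_le_sq_sum_of_nonneg fun _ _ => norm_nonneg _

lemma eLpNorm_le_sum_coord {F : Type*} [NormedAddCommGroup F] [NormedSpace ℝ F]
    {u : S n → PiLp 2 (fun _ : Fin n => F)} (hu : AEStronglyMeasurable u (σ n))
    {p : ℝ≥0∞} (hp : 1 ≤ p) :
    eLpNorm u p (σ n) ≤ ∑ l, eLpNorm (fun x => u x l) p (σ n) := by
  have hm : ∀ l, AEStronglyMeasurable (fun x => ‖u x l‖) (σ n) := fun l =>
    ((PiLp.proj (𝕜 := ℝ) 2 (fun _ : Fin n => F) l).continuous.comp_aestronglyMeasurable hu).norm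
  calc eLpNorm u p (σ n) ≤ eLpNorm (∑ l, fun x => ‖u x l‖) p (σ n) := by
        refine eLpNorm_mono_real fun x => ?_
        rw [Finset.sum_apply]
        exact norm_le_sum_norm _
    _ ≤ ∑ l, eLpNorm (fun x => ‖u x l‖) p (σ n) := eLpNorm_sum_le (fun l _ => hm l) hp
    _ = _ := by simp only [eLpNorm_norm]

lemma tendsto_zonalConvMap [n.AtLeastTwo] {p : ℝ≥0∞} (hp1 : 1 ≤ p) (hp : p ≠ ⊤) {u : S n → E n}
    (hu : MemLp u p (σ n)) :
    Tendsto (fun N => eLpNorm (fun x : S n => zonalConvMap N u x - u x) p (σ n)) atTop (𝓝 0) := by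
  have hi := hu.integrable hp1
  have h : Tendsto (fun N => ∑ l, eLpNorm (fun x : S n => zonalConv N (fun y => u y l) x - u x l)
      p (σ n)) atTop (𝓝 (∑ l : Fin n, 0)) :=
    tendsto_finsetSum _ fun l _ => tendsto_zonalConv hp1 hp (memLp_coord hu l)
  rw [Finset.sum_const_zero] at h
  refine tendsto_of_tendsto_of_tendsto_of_le_of_le tendsto_const_nhds h (fun _ => zero_le)
    fun N => eLpNorm_le_sum_coord ?_ hp1
  exact ((contDiff_zonalConvMap N hi).continuous.comp
    continuous_subtype_val).aestronglyMeasurable.sub hu.1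

lemma norm_rotGen_sphere_le (i j : Fin n) (x : S n) : ‖rotGen i j (x : E n)‖ ≤ 2 := by
  rw [rotGen_apply]
  have h : ∀ k, ‖(x : E n) k‖ ≤ 1 := fun k => by
    have := PiLp.norm_apply_le (x : E n) k
    simpa using this
  refine (norm_sub_le _ _).trans ?_
  rw [norm_smul, norm_smul]
  simp only [EuclideanSpace.single, PiLp.norm_single, norm_one, mul_one]
  linarith [h i, h j]

lemma memLp_inner_rotGen {G : S n → Mat n} {p : ℝ≥0∞} (hG : MemLp G p (σ n)) (l i j : Fin n) :
    MemLp (fun y : S n => ⟪G y l, rotGen i j y⟫) p (σ n) := by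
  have h := memLp_row hG l
  have hc : Continuous fun y : S n => rotGen i j (y : E n) := by fun_prop
  refine MemLp.of_le_mul (c := 2) h (h.1.inner hc.aestronglyMeasurable) (ae_of_all _ fun y => ?_)
  refine (norm_inner_le_norm _ _).trans ?_
  rw [mul_comm]
  exact mul_le_mul_of_nonneg_right (norm_rotGen_sphere_le i j y) (norm_nonneg _)

/-- The counterpart of `tangGrad_apply` for a tangential vector, needed because a weak gradient is
not given as a derivative. -/
lemma coord_eq_sum_rotGen (x : S n) {v : E n} (hv : ⟪v, (x : E n)⟫ = 0) (j : Fin n) :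
    v j = ∑ i, (x : E n) i * ⟪v, rotGen i j (x : E n)⟫ := by
  simp only [rotGen_apply, inner_sub_right, real_inner_smul_right,
    EuclideanSpace.inner_single_right, mul_sub, Finset.sum_sub_distrib]
  simp only [one_mul, conj_trivial, ← mul_assoc]
  rw [← Finset.sum_mul, sum_mul_self_sphere, one_mul]
  have : ∑ i, (x : E n) i * (x : E n) j * v i = (x : E n) j * ∑ i, v i * (x : E n) i := by
    rw [Finset.mul_sum]; exact Finset.sum_congr rfl fun _ _ => by ring
  rw [this, ← inner_eq_sum, hv]
  ring

/-- The gradients of the zonal regularizations converge to the weak gradient. -/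
lemma tendsto_tangGradMap_zonalConvMap [n.AtLeastTwo] {p : ℝ≥0∞} (hp1 : 1 ≤ p) (hp : p ≠ ⊤)
    {u : S n → E n} {G : S n → Mat n} (hu : Integrable u (σ n)) (hG : MemLp G p (σ n))
    (h : IsWeakGradient u G) :
    Tendsto (fun N => eLpNorm (fun x : S n => tangGradMap (zonalConvMap N u) x - G x) p (σ n))
      atTop (𝓝 0) := by
  have hlim : Tendsto (fun N => ∑ l, ∑ j, ∑ i, eLpNorm (fun x : S n =>
      zonalConv N (fun y => ⟪G y l, rotGen i j y⟫) x - ⟪G x l, rotGen i j x⟫) p (σ n))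
      atTop (𝓝 (∑ l : Fin n, ∑ j : Fin n, ∑ i : Fin n, 0)) :=
    tendsto_finsetSum _ fun l _ => tendsto_finsetSum _ fun j _ => tendsto_finsetSum _ fun i _ =>
      tendsto_zonalConv hp1 hp (memLp_inner_rotGen hG l i j)
  simp only [Finset.sum_const_zero] at hlim
  refine tendsto_of_tendsto_of_tendsto_of_le_of_le tendsto_const_nhds hlim (fun _ => zero_le)
    fun N => ?_
  have hm : AEStronglyMeasurable (fun x : S n => tangGradMap (zonalConvMap N u) x - G x) (σ n) :=
    ((continuous_tangGradMap (contDiff_zonalConvMap N hu)).comp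
      continuous_subtype_val).aestronglyMeasurable.sub hG.1
  refine (eLpNorm_le_sum_coord hm hp1).trans (Finset.sum_le_sum fun l _ => ?_)
  have hml := (PiLp.proj (𝕜 := ℝ) 2 (fun _ : Fin n => E n) l).continuous.comp_aestronglyMeasurable
    hm
  refine (eLpNorm_le_sum_coord hml hp1).trans (Finset.sum_le_sum fun j _ => ?_)
  set d : Fin n → S n → ℝ := fun i x =>
    zonalConv N (fun y => ⟪G y l, rotGen i j y⟫) x - ⟪G x l, rotGen i j (x : E n)⟫ with hd
  have hdm : ∀ i, AEStronglyMeasurable (d i) (σ n) := fun i =>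
    (continuous_zonalConv_sphere N
      ((memLp_inner_rotGen hG l i j).integrable hp1)).aestronglyMeasurable.sub
      (memLp_inner_rotGen hG l i j).1
  have hle : eLpNorm (fun x : S n => (tangGradMap (zonalConvMap N u) x - G x) l j) p (σ n) ≤
      eLpNorm (∑ i, fun x => ‖d i x‖) p (σ n) := by
    refine eLpNorm_mono_ae_real ?_
    filter_upwards [h.1] with x hx
    -- Both gradients are rebuilt from their rotational components, and on those components
    -- regularization is a plain average of an L^p function.
    have e1 : (tangGradMap (zonalConvMap N u) x - G x) l j = ∑ i, (x : E n) i * d i x := by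
      have e2 : tangGradMap (zonalConvMap N u) x l j = ∑ i, (x : E n) i *
          zonalConv N (fun y => ⟪G y l, rotGen i j y⟫) x := by
        have e3 : tangGradMap (zonalConvMap N u) x l = tangGrad (zonalConv N fun y => u y l) x :=
          rfl
        rw [e3, tangGrad_apply]
        exact Finset.sum_congr rfl fun i _ => by rw [fderiv_zonalConv_rotGen N hu h l i j x]
      rw [PiLp.sub_apply, PiLp.sub_apply, e2, coord_eq_sum_rotGen x (hx l) j,
        ← Finset.sum_sub_distrib]
      exact Finset.sum_congr rfl fun i _ => by rw [hd]; ring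
    rw [e1, Finset.sum_apply]
    refine (norm_sum_le _ _).trans (Finset.sum_le_sum fun i _ => ?_)
    rw [norm_mul]
    refine mul_le_of_le_one_left (norm_nonneg _) ?_
    have := PiLp.norm_apply_le (x : E n) i
    simpa using this
  refine hle.trans ((eLpNorm_sum_le (fun i _ => (hdm i).norm) hp1).trans ?_)
  simp only [eLpNorm_norm]
  exact le_rfl

end Vector

/-! ### Quantitative L¹ rate of averaging -/

section Poincare

variable {n : ℕ}

/-- Because the increment is an exact divergence in y, it can be integrated by parts against a weak
gradient. -/
lemma zonalKer_sub_succ [n.AtLeastTwo] (N : ℕ) (x y : S n) :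
    zonalKer N (x : E n) y - zonalKer (N + 1) (x : E n) y =
      sphereDiv (fun z => (1 + ⟪(x : E n), z⟫) ^ N • tangPart (x : E n) z) y /
        ((N + n - 1) * zonalMass n (N + 1)) := by
  rw [sphereDiv_zonal_tangPart, zonalKer, zonalKer, zonalMass_succ]
  have := one_lt_natCast (n := n)
  have : (0 : ℝ) ≤ N := N.cast_nonneg
  have h0 : (N + n - 1 : ℝ) ≠ 0 := by linarith
  have h1 : (2 * N + n - 1 : ℝ) ≠ 0 := by linarith
  have := (zonalMass_pos (n := n) N).ne'
  field_simp

/-- The increments of zonal regularization are controlled by the weak gradient. -/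
lemma zonalConv_sub_succ [n.AtLeastTwo] (N : ℕ) {u : S n → E n} {G : S n → Mat n}
    (hu : Integrable u (σ n)) (h : IsWeakGradient u G) (l : Fin n) (x : S n) :
    zonalConv N (fun y => u y l) x - zonalConv (N + 1) (fun y => u y l) x =
      -(∫ y : S n, (1 + ⟪(x : E n), (y : E n)⟫) ^ N * ⟪G y l, tangPart (x : E n) y⟫ ∂σ n) /
        ((N + n - 1) * zonalMass n (N + 1)) := by
  have hul := integrable_coord hu l
  have hw := h.2 (fun z => (1 + ⟪(x : E n), z⟫) ^ N • tangPart (x : E n) z)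
    ((contDiff_zonal _ _).smul (contDiff_tangPart _))
    (fun y => by rw [real_inner_smul_left, inner_tangPart, mul_zero]) l
  simp_rw [real_inner_smul_right] at hw
  rw [← hw, ← integral_div, zonalConv, zonalConv,
    ← integral_sub (integrable_zonalKer_mul N hul x) (integrable_zonalKer_mul (N + 1) hul x)]
  refine integral_congr_ae (ae_of_all _ fun y => ?_)
  simp only
  rw [← sub_mul, zonalKer_sub_succ]
  ring

/-- The length is √((1 + t)(1 - t)) with t = ⟨x, y⟩; the weighted arithmetic-geometric mean
inequality linearizes the root, so that only integer powers of 1 + t need to be integrated. -/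
lemma norm_tangPart_le (x y : S n) {s : ℝ} (hs : 0 < s) :
    ‖tangPart (x : E n) y‖ ≤
      (s * (1 - ⟪(x : E n), (y : E n)⟫) + (1 + ⟪(x : E n), (y : E n)⟫) / s) / 2 := by
  have h1 := neg_one_le_inner_sphere x y
  have h2 := inner_sphere_le x y
  set t := ⟪(x : E n), (y : E n)⟫ with ht
  have hsq : ‖tangPart (x : E n) y‖ ^ 2 = (1 + t) * (1 - t) := by
    rw [tangPart, norm_sub_sq_real, norm_smul, real_inner_smul_right, ← ht]
    simp
    ring
  refine abs_le_of_sq_le_sq' ?_ ?_ |>.2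
  · rw [hsq]
    have e : ((s * (1 - t) + (1 + t) / s) / 2) ^ 2 - (1 + t) * (1 - t) =
        ((s * (1 - t) - (1 + t) / s) / 2) ^ 2 := by
      field_simp
      ring
    nlinarith [sq_nonneg ((s * (1 - t) - (1 + t) / s) / 2)]
  · have : 0 ≤ s * (1 - t) := mul_nonneg hs.le (by linarith)
    positivity

/-- A kernel dominating the gradient kernel of the increments of zonal regularization. -/
def incrKer (N : ℕ) (x y : E n) : ℝ :=
  (√(N + 1) * (zonalKer N x y * (1 - ⟪x, y⟫) * zonalMass n N) +
    zonalKer (N + 1) x y * zonalMass n (N + 1) / √(N + 1)) / 2 /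
    ((N + n - 1) * zonalMass n (N + 1))

lemma incrKer_comm (N : ℕ) (x y : E n) : incrKer N x y = incrKer N y x := by
  simp only [incrKer, zonalKer_comm _ x y, real_inner_comm x y]

lemma continuous_incrKer (N : ℕ) : Continuous fun z : E n × E n => incrKer N z.1 z.2 := by
  have h1 := continuous_zonalKer (n := n) N
  have h2 := continuous_zonalKer (n := n) (N + 1)
  unfold incrKer
  fun_prop

lemma continuous_incrKer_comp {α : Type*} [TopologicalSpace α] (N : ℕ) {a b : α → E n}
    (ha : Continuous a) (hb : Continuous b) : Continuous fun w => incrKer N (a w) (b w) :=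
  (continuous_incrKer N).comp₂ ha hb

lemma zonal_mul_norm_tangPart_le [n.AtLeastTwo] (N : ℕ) (x y : S n) :
    (1 + ⟪(x : E n), (y : E n)⟫) ^ N * ‖tangPart (x : E n) y‖ /
      ((N + n - 1) * zonalMass n (N + 1)) ≤ incrKer N (x : E n) y := by
  have hn := one_lt_natCast (n := n)
  have hN : (0 : ℝ) ≤ N := N.cast_nonneg
  have hd : 0 < (N + n - 1) * zonalMass n (N + 1) :=
    mul_pos (by linarith) (zonalMass_pos _)
  have hs : 0 < √((N : ℝ) + 1) := Real.sqrt_pos.2 (by linarith)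
  rw [incrKer]
  refine div_le_div_of_nonneg_right ?_ hd.le
  have h := mul_le_mul_of_nonneg_left (norm_tangPart_le x y hs)
    (pow_nonneg (neg_one_le_inner_sphere x y) N)
  refine h.trans_eq ?_
  have h0 := (zonalMass_pos (n := n) N).ne'
  have h1 := (zonalMass_pos (n := n) (N + 1)).ne'
  rw [zonalKer, zonalKer, div_mul_cancel₀ _ h1]
  have : (1 + ⟪(x : E n), (y : E n)⟫) ^ N / zonalMass n N * (1 - ⟪(x : E n), (y : E n)⟫) *
      zonalMass n N = (1 + ⟪(x : E n), (y : E n)⟫) ^ N * (1 - ⟪(x : E n), (y : E n)⟫) := by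
    field_simp
  rw [this]
  ring

lemma incrKer_nonneg [n.AtLeastTwo] (N : ℕ) (x y : S n) : 0 ≤ incrKer N (x : E n) y := by
  have hn := one_lt_natCast (n := n)
  have hN : (0 : ℝ) ≤ N := N.cast_nonneg
  refine le_trans ?_ (zonal_mul_norm_tangPart_le N x y)
  exact div_nonneg (mul_nonneg (pow_nonneg (neg_one_le_inner_sphere x y) N) (norm_nonneg _))
    (mul_pos (by linarith) (zonalMass_pos _)).le

/-- The exponent 3/2 is what makes the increments summable: one power comes from the prefactor and
half a power from the concentration of the kernel. -/
lemma integral_incrKer_le [n.AtLeastTwo] (N : ℕ) (x : S n) :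
    ∫ y : S n, incrKer N (x : E n) y ∂σ n ≤ n / ((N + 1) * √(N + 1)) := by
  have hn := one_lt_natCast (n := n)
  have hn2 : (2 : ℝ) ≤ n := by exact_mod_cast (Nat.AtLeastTwo.prop : 2 ≤ n)
  have hN : (0 : ℝ) ≤ N := N.cast_nonneg
  have hs : 0 < √((N : ℝ) + 1) := Real.sqrt_pos.2 (by linarith)
  have hss : √((N : ℝ) + 1) * √((N : ℝ) + 1) = N + 1 := Real.mul_self_sqrt (by linarith)
  have h0 := zonalMass_pos (n := n) N
  have h1 := zonalMass_pos (n := n) (N + 1)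
  have h01 := zonalMass_le_succ (n := n) N
  have hc1 : Continuous fun y : S n => zonalKer N (x : E n) y :=
    (continuous_zonalKer_right N _).comp continuous_subtype_val
  have hc2 : Continuous fun y : S n => zonalKer (N + 1) (x : E n) y :=
    (continuous_zonalKer_right (N + 1) _).comp continuous_subtype_val
  simp only [incrKer]
  rw [integral_div, integral_div, integral_add (integrable_of_continuous (by fun_prop))
    (integrable_of_continuous (by fun_prop)), integral_const_mul, integral_mul_const,
    integral_zonalKer_mul, integral_div, integral_mul_const, integral_zonalKer, one_mul]
  set s := √((N : ℝ) + 1)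
  set A := zonalMass n N
  set B := zonalMass n (N + 1)
  have hd : (0 : ℝ) < N + n - 1 := by linarith
  -- The choice s² = N + 1 balances the two terms: both are of order B / s.
  have e1 : s * ((n - 1) / (N + n - 1) * A) ≤ (n - 1) * B / s := by
    rw [le_div_iff₀ hs]
    calc s * ((n - 1) / (N + n - 1) * A) * s = ((N + 1) / (N + n - 1)) * ((n - 1) * A) := by
          rw [← hss]; ring
      _ ≤ 1 * ((n - 1) * B) := by
          have : ((N : ℝ) + 1) / (N + n - 1) ≤ 1 := by rw [div_le_one hd]; linarith
          have : (n - 1 : ℝ) * A ≤ (n - 1) * B := by gcongr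
          have : 0 ≤ (n - 1 : ℝ) * A := mul_nonneg (by linarith) h0.le
          gcongr
      _ = _ := one_mul _
  calc (s * ((n - 1) / (N + n - 1) * A) + B / s) / 2 / ((N + n - 1) * B)
      ≤ ((n - 1) * B / s + B / s) / 2 / ((N + n - 1) * B) := by gcongr
    _ = n / (2 * (N + n - 1) * s) := by field_simp; ring
    _ ≤ n / ((N + 1) * s) := by gcongr; linarith

lemma enorm_zonalConv_sub_succ_le [n.AtLeastTwo] (N : ℕ) {u : S n → E n} {G : S n → Mat n}
    (hu : Integrable u (σ n)) (h : IsWeakGradient u G) (l : Fin n) (x : S n) :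
    ‖zonalConv N (fun y => u y l) x - zonalConv (N + 1) (fun y => u y l) x‖ₑ ≤
      ∫⁻ y, ENNReal.ofReal (incrKer N (x : E n) y) * ‖G y‖ₑ ∂σ n := by
  have hn := one_lt_natCast (n := n)
  have hN : (0 : ℝ) ≤ N := N.cast_nonneg
  have hd : 0 < (N + n - 1) * zonalMass n (N + 1) :=
    mul_pos (by linarith) (zonalMass_pos _)
  rw [zonalConv_sub_succ N hu h l x, neg_div, enorm_neg, ← integral_div]
  refine (enorm_integral_le_lintegral_enorm _).trans (lintegral_mono fun y => ?_)
  rw [← ofReal_norm, ← ofReal_norm, ← ENNReal.ofReal_mul (incrKer_nonneg N x y)]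
  refine ENNReal.ofReal_le_ofReal ?_
  rw [norm_div, norm_mul, Real.norm_of_nonneg (pow_nonneg (neg_one_le_inner_sphere x y) N),
    Real.norm_of_nonneg hd.le]
  have h1 : ‖⟪G y l, tangPart (x : E n) y⟫‖ ≤ ‖tangPart (x : E n) y‖ * ‖G y‖ := by
    refine (norm_inner_le_norm _ _).trans ?_
    rw [mul_comm]
    exact mul_le_mul_of_nonneg_left (PiLp.norm_apply_le (G y) l) (norm_nonneg _)
  calc _ ≤ (1 + ⟪(x : E n), (y : E n)⟫) ^ N * (‖tangPart (x : E n) y‖ * ‖G y‖) /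
        ((N + n - 1) * zonalMass n (N + 1)) :=
        div_le_div_of_nonneg_right (mul_le_mul_of_nonneg_left h1
          (pow_nonneg (neg_one_le_inner_sphere x y) N)) hd.le
    _ = (1 + ⟪(x : E n), (y : E n)⟫) ^ N * ‖tangPart (x : E n) y‖ /
        ((N + n - 1) * zonalMass n (N + 1)) * ‖G y‖ := by ring
    _ ≤ _ := mul_le_mul_of_nonneg_right (zonal_mul_norm_tangPart_le N x y) (norm_nonneg _)

/-- The kernel is symmetric, so the mass in the first variable, which is the one needed for the L¹
bound by Tonelli, obeys the same estimate. -/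
lemma lintegral_incrKer_le [n.AtLeastTwo] (N : ℕ) (y : S n) :
    ∫⁻ x : S n, ENNReal.ofReal (incrKer N (x : E n) y) ∂σ n ≤
      ENNReal.ofReal (n / ((N + 1) * √(N + 1))) := by
  have hc : Continuous fun x : S n => incrKer N (x : E n) (y : E n) :=
    continuous_incrKer_comp N continuous_subtype_val continuous_const
  rw [← ofReal_integral_eq_lintegral_ofReal (integrable_of_continuous hc)
    (ae_of_all _ fun x => incrKer_nonneg N x y)]
  refine ENNReal.ofReal_le_ofReal ?_
  simp_rw [fun x : S n => incrKer_comm N (x : E n) (y : E n)]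
  exact integral_incrKer_le N y

lemma eLpNorm_zonalConv_sub_succ_le [n.AtLeastTwo] (N : ℕ) {u : S n → E n} {G : S n → Mat n}
    (hu : Integrable u (σ n)) (hG : Integrable G (σ n)) (h : IsWeakGradient u G) (l : Fin n) :
    eLpNorm (fun x : S n =>
        zonalConv N (fun y => u y l) x - zonalConv (N + 1) (fun y => u y l) x) 1 (σ n) ≤
      ENNReal.ofReal (n / ((N + 1) * √(N + 1))) * eLpNorm G 1 (σ n) := by
  have hk : Continuous fun z : S n × S n => incrKer N (z.1 : E n) z.2 :=
    continuous_incrKer_comp N (continuous_subtype_val.comp continuous_fst)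
      (continuous_subtype_val.comp continuous_snd)
  have hswap := lintegral_kernel_swap hk hG.1.enorm
  rw [eLpNorm_one_eq_lintegral_enorm, eLpNorm_one_eq_lintegral_enorm]
  refine (lintegral_mono fun x => enorm_zonalConv_sub_succ_le N hu h l x).trans
    (hswap.le.trans ?_)
  rw [← lintegral_const_mul'' _ hG.1.enorm]
  exact lintegral_mono fun y => mul_le_mul_left (lintegral_incrKer_le N y) _

lemma tsum_incr_ne_top :
    ∑' N : ℕ, ENNReal.ofReal (n / ((N + 1) * √(N + 1))) ≠ ⊤ := by
  have h : Summable fun N : ℕ => (n : ℝ) / ((N + 1) * √(N + 1)) := by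
    have h1 := (summable_nat_add_iff 1).2
      (Real.summable_nat_rpow_inv.2 (show (1 : ℝ) < 3 / 2 by norm_num))
    refine (h1.mul_left (n : ℝ)).congr fun N => ?_
    have hN : (0 : ℝ) < N + 1 := by positivity
    have e : ((N + 1 : ℕ) : ℝ) ^ (3 / 2 : ℝ) = (N + 1) * √(N + 1) := by
      rw [show (3 / 2 : ℝ) = 1 + 1 / 2 by norm_num, Nat.cast_succ, Real.rpow_add hN, Real.rpow_one,
        Real.sqrt_eq_rpow]
    rw [← e, div_eq_mul_inv (n : ℝ)]
  exact h.tsum_ofReal_ne_top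

/-- The rate of convergence of zonal regularization in `L¹`, in terms of the weak gradient. -/
def zonalRate (n N : ℕ) : ℝ≥0∞ :=
  ∑' k : ℕ, ENNReal.ofReal (n / (((k + N : ℕ) + 1) * √((k + N : ℕ) + 1)))

lemma tendsto_zonalRate : Tendsto (zonalRate n) atTop (𝓝 0) :=
  ENNReal.tendsto_sum_nat_add
    (fun N : ℕ => ENNReal.ofReal (n / ((N + 1) * √(N + 1)))) tsum_incr_ne_top

/-- Telescoping from N to N + M costs at most the tail of the series; then M → ∞ and the averages
converge to u in L¹. -/
lemma eLpNorm_zonalConv_sub_le [n.AtLeastTwo] (N : ℕ) {u : S n → E n} {G : S n → Mat n}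
    (hu : Integrable u (σ n)) (hG : Integrable G (σ n)) (h : IsWeakGradient u G) (l : Fin n) :
    eLpNorm (fun x : S n => zonalConv N (fun y => u y l) x - u x l) 1 (σ n) ≤
      zonalRate n N * eLpNorm G 1 (σ n) := by
  have hul := integrable_coord hu l
  set T : ℕ → S n → ℝ := fun M x => zonalConv M (fun y => u y l) x with hT
  have hTm : ∀ M, AEStronglyMeasurable (T M) (σ n) := fun M =>
    (continuous_zonalConv_sphere M hul).aestronglyMeasurable
  have hbound : ∀ M, eLpNorm (T N - T (M + N)) 1 (σ n) ≤
      (∑ k ∈ Finset.range M, ENNReal.ofReal (n / (((k + N : ℕ) + 1) * √((k + N : ℕ) + 1)))) *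
        eLpNorm G 1 (σ n) := by
    intro M
    induction M with
    | zero => simp
    | succ M ih =>
      have hdec : T N - T (M + 1 + N) = (T N - T (M + N)) + (T (M + N) - T (M + N + 1)) := by
        rw [add_right_comm]; abel
      rw [hdec, Finset.sum_range_succ, add_mul]
      exact (eLpNorm_add_le ((hTm _).sub (hTm _)) ((hTm _).sub (hTm _)) le_rfl).trans
        (add_le_add ih (eLpNorm_zonalConv_sub_succ_le (M + N) hu hG h l))
  have hlim := (tendsto_zonalConv le_rfl ENNReal.one_ne_top
    (memLp_one_iff_integrable.2 hul)).comp (tendsto_add_atTop_nat N)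
  have hlim' := hlim.const_add (zonalRate n N * eLpNorm G 1 (σ n))
  rw [add_zero] at hlim'
  refine ge_of_tendsto' hlim' fun M => ?_
  have hdec : (fun x : S n => zonalConv N (fun y => u y l) x - u x l) =
      (T N - T (M + N)) + fun x => T (M + N) x - u x l := by
    funext x; simp [hT]
  rw [hdec]
  refine (eLpNorm_add_le ((hTm _).sub (hTm _)) ((hTm _).sub hul.1) le_rfl).trans
    (add_le_add ((hbound M).trans ?_) le_rfl)
  exact mul_le_mul_left (ENNReal.sum_le_tsum _) _

end Poincare

/-! ### Algebra of the p-Laplacian flux -/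

section PLaplace

variable {V : Type*} [NormedAddCommGroup V] [InnerProductSpace ℝ V]

/-- The nonlinearity `|a|^{p-2} a` of the `p`-Laplacian. -/
def pFlux (p : ℝ) (a : V) : V := ‖a‖ ^ (p - 2) • a

lemma norm_pFlux {p : ℝ} (hp : 2 ≤ p) (a : V) : ‖pFlux p a‖ = ‖a‖ ^ (p - 1) := by
  rw [pFlux, norm_smul, Real.norm_of_nonneg (by positivity)]
  rcases eq_or_ne a 0 with rfl | ha
  · simp [Real.zero_rpow (by linarith : p - 1 ≠ 0)]
  · nth_rewrite 2 [← Real.rpow_one ‖a‖]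
    rw [← Real.rpow_add (norm_pos_iff.2 ha)]
    ring_nf

/-- Strong monotonicity of the `p`-Laplacian for `p ≥ 2`. -/
lemma pFlux_monotone {p : ℝ} (hp : 2 ≤ p) (a b : V) :
    2 ^ (1 - p) * ‖a - b‖ ^ p ≤ ⟪pFlux p a - pFlux p b, a - b⟫ := by
  have hp2 : 0 ≤ p - 2 := by linarith
  have hA : (0 : ℝ) ≤ ‖a‖ ^ (p - 2) := by positivity
  have hB : (0 : ℝ) ≤ ‖b‖ ^ (p - 2) := by positivity
  -- Symmetrizing in the two weights leaves a cross term that is nonnegative, since t ↦ t^{p-2} and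
  -- t ↦ t² are both nondecreasing on t ≥ 0.
  have hid : ⟪pFlux p a - pFlux p b, a - b⟫ =
      (‖a‖ ^ (p - 2) + ‖b‖ ^ (p - 2)) / 2 * ‖a - b‖ ^ 2 +
        (‖a‖ ^ (p - 2) - ‖b‖ ^ (p - 2)) * (‖a‖ ^ 2 - ‖b‖ ^ 2) / 2 := by
    rw [norm_sub_sq_real]
    simp only [pFlux, inner_sub_left, inner_sub_right, real_inner_smul_left,
      real_inner_self_eq_norm_sq, real_inner_comm a b]
    ring
  have hcross : 0 ≤ (‖a‖ ^ (p - 2) - ‖b‖ ^ (p - 2)) * (‖a‖ ^ 2 - ‖b‖ ^ 2) := by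
    rcases le_total ‖a‖ ‖b‖ with h | h
    · have h1 := Real.rpow_le_rpow (norm_nonneg a) h hp2
      have h2 : ‖a‖ ^ 2 ≤ ‖b‖ ^ 2 := by gcongr
      exact mul_nonneg_of_nonpos_of_nonpos (by linarith) (by linarith)
    · have h1 := Real.rpow_le_rpow (norm_nonneg b) h hp2
      have h2 : ‖b‖ ^ 2 ≤ ‖a‖ ^ 2 := by gcongr
      exact mul_nonneg (by linarith) (by linarith)
  have hmax : ‖a - b‖ ^ (p - 2) ≤ 2 ^ (p - 2) * (‖a‖ ^ (p - 2) + ‖b‖ ^ (p - 2)) := by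
    have h1 : ‖a - b‖ ≤ 2 * max ‖a‖ ‖b‖ :=
      (norm_sub_le a b).trans (by linarith [le_max_left ‖a‖ ‖b‖, le_max_right ‖a‖ ‖b‖])
    refine (Real.rpow_le_rpow (norm_nonneg _) h1 hp2).trans ?_
    rw [Real.mul_rpow (by norm_num) (le_max_of_le_left (norm_nonneg _))]
    refine mul_le_mul_of_nonneg_left ?_ (by positivity)
    rcases max_choice ‖a‖ ‖b‖ with h | h <;> rw [h] <;> linarith
  have hsplit : ‖a - b‖ ^ p = ‖a - b‖ ^ (p - 2) * ‖a - b‖ ^ 2 := by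
    rcases eq_or_lt_of_le (norm_nonneg (a - b)) with h | h
    · rw [← h]; simp [Real.zero_rpow (by linarith : p ≠ 0)]
    · rw [← Real.rpow_natCast, ← Real.rpow_add h]; norm_num
  have hc : (2 : ℝ) ^ (1 - p) * 2 ^ (p - 2) = 1 / 2 := by
    rw [← Real.rpow_add (by norm_num), show 1 - p + (p - 2) = -1 by ring, Real.rpow_neg_one]
    norm_num
  rw [hid, hsplit]
  have h2 : (0 : ℝ) < 2 ^ (1 - p) := by positivity
  calc 2 ^ (1 - p) * (‖a - b‖ ^ (p - 2) * ‖a - b‖ ^ 2)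
      ≤ 2 ^ (1 - p) * (2 ^ (p - 2) * (‖a‖ ^ (p - 2) + ‖b‖ ^ (p - 2)) * ‖a - b‖ ^ 2) := by gcongr
    _ = (2 ^ (1 - p) * 2 ^ (p - 2)) * (‖a‖ ^ (p - 2) + ‖b‖ ^ (p - 2)) * ‖a - b‖ ^ 2 := by ring
    _ = (‖a‖ ^ (p - 2) + ‖b‖ ^ (p - 2)) / 2 * ‖a - b‖ ^ 2 := by rw [hc]; ring
    _ ≤ _ := by linarith

end PLaplace

/-! ### Hölder pairings, dominated convergence and convergence in measure -/

section LpTools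

variable {α : Type*} [MeasurableSpace α] {μ : Measure α}
  {V : Type*} [NormedAddCommGroup V] [InnerProductSpace ℝ V]

lemma aestronglyMeasurable_pFlux {p : ℝ} {G : α → V} (hG : AEStronglyMeasurable G μ) :
    AEStronglyMeasurable (fun x => pFlux p (G x)) μ := by
  have h : AEStronglyMeasurable (fun x => ‖G x‖ ^ (p - 2)) μ :=
    (hG.norm.aemeasurable.pow_const _).aestronglyMeasurable
  exact h.smul hG

/-- The exponents match because p'(p - 1) = p. -/
lemma eLpNorm_pFlux {p : ℝ} (hp : 2 ≤ p) (G : α → V) :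
    eLpNorm (fun x => pFlux p (G x)) (ENNReal.ofReal p.conjExponent) μ =
      eLpNorm G (ENNReal.ofReal p) μ ^ (p - 1) := by
  have h1 : eLpNorm (fun x => pFlux p (G x)) (ENNReal.ofReal p.conjExponent) μ =
      eLpNorm (fun x => ‖G x‖ ^ (p - 1)) (ENNReal.ofReal p.conjExponent) μ :=
    eLpNorm_congr_norm_ae (ae_of_all _ fun x => by
      rw [norm_pFlux hp, Real.norm_of_nonneg (by positivity)])
  have hc : 0 ≤ p.conjExponent := div_nonneg (by linarith) (by linarith)
  rw [h1, eLpNorm_norm_rpow _ (by linarith), ← ENNReal.ofReal_mul hc]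
  congr 3
  rw [Real.conjExponent]
  exact div_mul_cancel₀ _ (by linarith)

lemma memLp_pFlux {p : ℝ} (hp : 2 ≤ p) {G : α → V} (hG : MemLp G (ENNReal.ofReal p) μ) :
    MemLp (fun x => pFlux p (G x)) (ENNReal.ofReal p.conjExponent) μ := by
  refine ⟨aestronglyMeasurable_pFlux hG.1, ?_⟩
  rw [eLpNorm_pFlux hp]
  exact ENNReal.rpow_lt_top_of_nonneg (by linarith) hG.2.ne

lemma eLpNorm_inner_le {r s : ℝ≥0∞} [ENNReal.HolderConjugate r s] {A B : α → V}
    (hA : AEStronglyMeasurable A μ) (hB : AEStronglyMeasurable B μ) :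
    eLpNorm (fun x => ⟪A x, B x⟫) 1 μ ≤ eLpNorm A r μ * eLpNorm B s μ := by
  have := eLpNorm_le_eLpNorm_mul_eLpNorm_of_nnnorm (p := r) (q := s) (r := 1) hA hB
    (fun a b => ⟪a, b⟫) 1 (ae_of_all _ fun x => by
      rw [one_mul]; exact nnnorm_inner_le_nnnorm _ _)
  simpa using this

lemma integrable_inner_of_memLp {r s : ℝ≥0∞} [ENNReal.HolderConjugate r s] {A B : α → V}
    (hA : MemLp A r μ) (hB : MemLp B s μ) : Integrable (fun x => ⟪A x, B x⟫) μ := by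
  rw [← memLp_one_iff_integrable]
  exact ⟨hA.1.inner hB.1,
    (eLpNorm_inner_le hA.1 hB.1).trans_lt (ENNReal.mul_lt_top hA.2 hB.2)⟩

lemma enorm_integral_inner_le {r s : ℝ≥0∞} [ENNReal.HolderConjugate r s] {A B : α → V}
    (hA : AEStronglyMeasurable A μ) (hB : AEStronglyMeasurable B μ) :
    ‖∫ x, ⟪A x, B x⟫ ∂μ‖ₑ ≤ eLpNorm A r μ * eLpNorm B s μ := by
  refine (enorm_integral_le_lintegral_enorm _).trans ?_
  rw [← eLpNorm_one_eq_lintegral_enorm]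
  exact eLpNorm_inner_le hA hB

/-- The pairing of a bounded sequence with a null sequence tends to zero. -/
lemma tendsto_integral_inner {r s : ℝ≥0∞} [ENNReal.HolderConjugate r s] {A B : ℕ → α → V}
    (hA : ∀ j, AEStronglyMeasurable (A j) μ) (hB : ∀ j, AEStronglyMeasurable (B j) μ)
    {K : ℝ≥0∞} (hK : K ≠ ⊤) (hAK : ∀ j, eLpNorm (A j) r μ ≤ K)
    (hB0 : Tendsto (fun j => eLpNorm (B j) s μ) atTop (𝓝 0)) :
    Tendsto (fun j => ∫ x, ⟪A j x, B j x⟫ ∂μ) atTop (𝓝 0) := by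
  rw [tendsto_zero_iff_enorm_tendsto_zero]
  have h := ENNReal.Tendsto.const_mul hB0 (Or.inr hK)
  rw [mul_zero] at h
  refine tendsto_of_tendsto_of_tendsto_of_le_of_le tendsto_const_nhds h (fun _ => zero_le)
    fun j => ?_
  exact (enorm_integral_inner_le (hA j) (hB j)).trans (mul_le_mul_left (hAK j) _)

/-- Dominated convergence to zero in `Lʳ`. -/
lemma tendsto_eLpNorm_of_dominated {F : Type*} [NormedAddCommGroup F] {r : ℝ≥0∞} (hr0 : r ≠ 0)
    (hr : r ≠ ⊤) {f : ℕ → α → F} {h : α → ℝ} (hf : ∀ j, AEStronglyMeasurable (f j) μ)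
    (hh : MemLp h r μ) (hfh : ∀ j, ∀ᵐ x ∂μ, ‖f j x‖ ≤ h x)
    (hlim : ∀ᵐ x ∂μ, Tendsto (fun j => f j x) atTop (𝓝 0)) :
    Tendsto (fun j => eLpNorm (f j) r μ) atTop (𝓝 0) := by
  have hpos : 0 < r.toReal := ENNReal.toReal_pos hr0 hr
  simp_rw [eLpNorm_eq_lintegral_rpow_enorm_toReal hr0 hr]
  have hfin : ∫⁻ x, ‖h x‖ₑ ^ r.toReal ∂μ ≠ ⊤ :=
    (lintegral_rpow_enorm_lt_top_of_eLpNorm_lt_top hr0 hr hh.2).ne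
  have key : Tendsto (fun j => ∫⁻ x, ‖f j x‖ₑ ^ r.toReal ∂μ) atTop (𝓝 (∫⁻ _, 0 ∂μ)) := by
    refine tendsto_lintegral_of_dominated_convergence' (fun x => ‖h x‖ₑ ^ r.toReal)
      (fun j => (hf j).enorm.pow_const _) (fun j => ?_) hfin ?_
    · filter_upwards [hfh j] with x hx
      refine ENNReal.rpow_le_rpow ?_ hpos.le
      exact enorm_le_iff_norm_le.2 (hx.trans (Real.le_norm_self _))
    · filter_upwards [hlim] with x hx
      have h1 := (tendsto_zero_iff_enorm_tendsto_zero.1 hx).ennrpow_const r.toReal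
      rwa [ENNReal.zero_rpow_of_pos hpos] at h1
  rw [lintegral_zero] at key
  have := key.ennrpow_const (1 / r.toReal)
  rwa [ENNReal.zero_rpow_of_pos (by positivity)] at this

/-- Convergence in measure and boundedness in `Lᵖ` imply convergence in `L^q` for `q < p`. -/
lemma tendsto_eLpNorm_of_tendstoInMeasure [IsProbabilityMeasure μ] {F : Type*}
    [NormedAddCommGroup F] {p q : ℝ} (hq : 1 ≤ q) (hqp : q < p)
    {f : ℕ → α → F} (hf : ∀ j, StronglyMeasurable (f j)) {K : ℝ≥0∞} (hK : K ≠ ⊤)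
    (hfK : ∀ j, eLpNorm (f j) (ENNReal.ofReal p) μ ≤ K)
    (hlim : TendstoInMeasure μ f atTop fun _ => 0) :
    Tendsto (fun j => eLpNorm (f j) (ENNReal.ofReal q) μ) atTop (𝓝 0) := by
  have hq0 : 0 < q := by linarith
  have hp0 : 0 < p := by linarith
  have hq1 : 1 ≤ ENNReal.ofReal q := by simpa using hq
  -- The power of the measure of the set where f_j is large that Hölder's inequality yields between
  -- L^q and L^p; off this set f_j is below δ.
  set e : ℝ := 1 / q - 1 / p with he
  have hepos : 0 < e := sub_pos.2 (one_div_lt_one_div_of_lt hq0 hqp)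
  rw [ENNReal.tendsto_nhds_zero]
  intro ε hε
  set δ : ℝ≥0∞ := min (ε / 2) 1 with hδ
  have hδtop : δ ≠ ⊤ := ((min_le_right _ _).trans_lt ENNReal.one_lt_top).ne
  have hδ0 : 0 < δ := lt_min (ENNReal.div_pos hε.ne' (by simp)) one_pos
  have hm := hlim δ hδ0
  have hm2 := ENNReal.Tendsto.const_mul (hm.ennrpow_const e) (Or.inr hK)
  rw [ENNReal.zero_rpow_of_pos hepos, mul_zero] at hm2
  filter_upwards [(ENNReal.tendsto_nhds_zero.1 hm2) (ε / 2) (ENNReal.div_pos hε.ne' (by simp))]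
    with j hj
  set s : Set α := {x | δ ≤ edist (f j x) 0} with hs
  have hsm : MeasurableSet s := by
    have : Measurable fun x => edist (f j x) 0 := by
      simp_rw [edist_zero_right]; exact (hf j).enorm
    exact measurableSet_le measurable_const this
  have hdec : f j = s.indicator (f j) + sᶜ.indicator (f j) :=
    (Set.indicator_self_add_compl s (f j)).symm
  have h1 : eLpNorm (s.indicator (f j)) (ENNReal.ofReal q) μ ≤ ε / 2 := by
    rw [eLpNorm_indicator_eq_eLpNorm_restrict hsm]
    refine (eLpNorm_le_eLpNorm_mul_rpow_measure_univ (ENNReal.ofReal_le_ofReal hqp.le)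
      (hf j).aestronglyMeasurable).trans ?_
    rw [Measure.restrict_apply_univ, ENNReal.toReal_ofReal hq0.le, ENNReal.toReal_ofReal hp0.le]
    refine le_trans (mul_le_mul_left ?_ _) hj
    exact (eLpNorm_mono_measure _ Measure.restrict_le_self).trans (hfK j)
  have h2 : eLpNorm (sᶜ.indicator (f j)) (ENNReal.ofReal q) μ ≤ ε / 2 := by
    refine (eLpNorm_le_of_ae_bound (C := δ.toReal) (ae_of_all _ fun x => ?_)).trans ?_
    · by_cases hx : x ∈ s
      · simp [hx]
      · have hx' : edist (f j x) 0 < δ := not_le.1 hx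
        rw [edist_zero_right] at hx'
        rw [Set.indicator_of_mem (by exact hx)]
        rw [← toReal_enorm]
        exact ENNReal.toReal_mono hδtop hx'.le
    · rw [measure_univ, ENNReal.one_rpow, one_mul, ENNReal.ofReal_toReal hδtop]
      exact min_le_left _ _
  rw [hdec]
  refine (eLpNorm_add_le ((hf j).indicator hsm).aestronglyMeasurable
    ((hf j).indicator hsm.compl).aestronglyMeasurable hq1).trans ?_
  exact (add_le_add h1 h2).trans_eq (ENNReal.add_halves ε)

end LpTools

/-! ### Norms and functionals on the Sobolev space -/

section SobolevSpace

variable {n : ℕ} {p : ℝ≥0∞} [Fact (1 ≤ p)]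

lemma memLp_toMap (w : W n p) : MemLp (toMap w) p (σ n) := Lp.memLp w.1.1

lemma memLp_grad (w : W n p) : MemLp (grad w) p (σ n) := Lp.memLp w.1.2

lemma integrable_toMap (w : W n p) : Integrable (toMap w) (σ n) :=
  (memLp_toMap w).integrable Fact.out

lemma isWeakGradient_grad (w : W n p) : IsWeakGradient (toMap w) (grad w) := w.2

lemma eLpNorm_toMap_le (w : W n p) : eLpNorm (toMap w) p (σ n) ≤ ENNReal.ofReal ‖w‖ := by
  rw [show eLpNorm (toMap w) p (σ n) = ENNReal.ofReal ‖w.1.1‖ by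
    rw [Lp.norm_def, ENNReal.ofReal_toReal (Lp.eLpNorm_ne_top _)]; rfl]
  exact ENNReal.ofReal_le_ofReal (norm_fst_le w.1)

lemma eLpNorm_grad_le (w : W n p) : eLpNorm (grad w) p (σ n) ≤ ENNReal.ofReal ‖w‖ := by
  rw [show eLpNorm (grad w) p (σ n) = ENNReal.ofReal ‖w.1.2‖ by
    rw [Lp.norm_def, ENNReal.ofReal_toReal (Lp.eLpNorm_ne_top _)]; rfl]
  exact ENNReal.ofReal_le_ofReal (norm_snd_le w.1)

lemma norm_le_of_eLpNorm (w : W n p) {C : ℝ} (hC : 0 ≤ C)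
    (h1 : eLpNorm (toMap w) p (σ n) ≤ ENNReal.ofReal C)
    (h2 : eLpNorm (grad w) p (σ n) ≤ ENNReal.ofReal C) : ‖w‖ ≤ C := by
  have e1 : ‖w.1.1‖ ≤ C := by
    rw [Lp.norm_def]; exact ENNReal.toReal_le_of_le_ofReal hC h1
  have e2 : ‖w.1.2‖ ≤ C := by
    rw [Lp.norm_def]; exact ENNReal.toReal_le_of_le_ofReal hC h2
  exact norm_prod_le_iff.2 ⟨e1, e2⟩

lemma toMap_sub (w z : W n p) : toMap (w - z) =ᵐ[σ n] fun x => toMap w x - toMap z x :=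
  Lp.coeFn_sub w.1.1 z.1.1

lemma grad_sub (w z : W n p) : grad (w - z) =ᵐ[σ n] fun x => grad w x - grad z x :=
  Lp.coeFn_sub w.1.2 z.1.2

/-- Pairing the map with an `L^{p'}` function is a bounded functional on `W^{1,p}`. -/
lemma exists_dual_toMap {r : ℝ≥0∞} [Fact (1 ≤ r)] [ENNReal.HolderConjugate r p] {A : S n → E n}
    (hA : MemLp A r (σ n)) : ∃ ℓ : WDual n p, ∀ w, ℓ w = ∫ x, ⟪A x, toMap w x⟫ ∂σ n := by
  refine ⟨((innerSL ℝ).lpPairing (σ n) r p (hA.toLp A)).comp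
    ((ContinuousLinearMap.fst ℝ _ _).comp (W n p).subtypeL), fun w => ?_⟩
  refine (ContinuousLinearMap.lpPairing_eq_integral _ _ _).trans (integral_congr_ae ?_)
  filter_upwards [hA.coeFn_toLp] with x hx
  rw [hx]; rfl

/-- Pairing the gradient with an `L^{p'}` function is a bounded functional on `W^{1,p}`. -/
lemma exists_dual_grad {r : ℝ≥0∞} [Fact (1 ≤ r)] [ENNReal.HolderConjugate r p] {A : S n → Mat n}
    (hA : MemLp A r (σ n)) : ∃ ℓ : WDual n p, ∀ w, ℓ w = ∫ x, ⟪A x, grad w x⟫ ∂σ n := by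
  refine ⟨((innerSL ℝ).lpPairing (σ n) r p (hA.toLp A)).comp
    ((ContinuousLinearMap.snd ℝ _ _).comp (W n p).subtypeL), fun w => ?_⟩
  refine (ContinuousLinearMap.lpPairing_eq_integral _ _ _).trans (integral_congr_ae ?_)
  filter_upwards [hA.coeFn_toLp] with x hx
  rw [hx]; rfl

end SobolevSpace

/-! ### Rellich compactness -/

section Rellich

variable {n : ℕ} {p : ℝ≥0∞} [Fact (1 ≤ p)]

/-- For fixed N and x, evaluating the average at x is a bounded linear functional of the Sobolev
map. -/
lemma tendsto_zonalConv_of_weak {r : ℝ≥0∞} [Fact (1 ≤ r)] [ENNReal.HolderConjugate r p]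
    {u : ℕ → W n p} (hu : ∀ ℓ : WDual n p, Tendsto (fun j => ℓ (u j)) atTop (𝓝 0))
    (N : ℕ) (l : Fin n) (x : E n) :
    Tendsto (fun j => zonalConv N (fun y => toMap (u j) y l) x) atTop (𝓝 0) := by
  have hc : Continuous fun y : S n => zonalKer N x y • EuclideanSpace.single l (1 : ℝ) :=
    ((continuous_zonalKer_right N x).comp continuous_subtype_val).smul continuous_const
  obtain ⟨ℓ, hℓ⟩ := exists_dual_toMap (p := p) (memLp_of_continuous hc r)
  refine (hu ℓ).congr fun j => ?_
  rw [hℓ, zonalConv]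
  refine integral_congr_ae (ae_of_all _ fun y => ?_)
  simp [real_inner_smul_left, EuclideanSpace.inner_single_left]

lemma exists_bound_zonalConv (N : ℕ) : ∃ C : ℝ, 0 ≤ C ∧ ∀ (f : S n → ℝ), Integrable f (σ n) →
    ∀ x : S n, ‖zonalConv N f x‖ ≤ C * ∫ y, ‖f y‖ ∂σ n := by
  have hk : Continuous fun z : S n × S n => zonalKer N (z.1 : E n) z.2 :=
    (continuous_zonalKer N).comp₂ (continuous_subtype_val.comp continuous_fst)
      (continuous_subtype_val.comp continuous_snd)
  obtain ⟨C, hC⟩ := (isCompact_univ (X := S n × S n)).exists_bound_of_continuousOn hk.continuousOn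
  refine ⟨max C 0, le_max_right _ _, fun f hf x => ?_⟩
  rw [← integral_const_mul]
  refine norm_integral_le_of_norm_le (hf.norm.const_mul _) (ae_of_all _ fun y => ?_)
  rw [norm_mul]
  exact mul_le_mul_of_nonneg_right ((hC (x, y) trivial).trans (le_max_left _ _)) (norm_nonneg _)

/-- Compactness of the embedding of `W^{1,p}` into `L¹`. -/
lemma tendsto_eLpNorm_one_of_weak [n.AtLeastTwo] {r : ℝ≥0∞} [Fact (1 ≤ r)]
    [ENNReal.HolderConjugate r p] {u : ℕ → W n p} {K : ℝ} (hK : ∀ j, ‖u j‖ ≤ K)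
    (hu : ∀ ℓ : WDual n p, Tendsto (fun j => ℓ (u j)) atTop (𝓝 0)) :
    Tendsto (fun j => eLpNorm (toMap (u j)) 1 (σ n)) atTop (𝓝 0) := by
  have hp1 : (1 : ℝ≥0∞) ≤ p := Fact.out
  have hK0 : 0 ≤ K := (norm_nonneg _).trans (hK 0)
  have hG1 : ∀ j, eLpNorm (grad (u j)) 1 (σ n) ≤ ENNReal.ofReal K := fun j =>
    (eLpNorm_le_eLpNorm_of_exponent_le hp1 (memLp_grad (u j)).1).trans
      ((eLpNorm_grad_le _).trans (ENNReal.ofReal_le_ofReal (hK j)))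
  have hcoord : ∀ l, Tendsto (fun j => eLpNorm (fun x => toMap (u j) x l) 1 (σ n))
      atTop (𝓝 0) := by
    intro l
    have hi : ∀ j, Integrable (fun x => toMap (u j) x l) (σ n) := fun j =>
      integrable_coord (integrable_toMap _) l
    have hnorm : ∀ j, ∫ y, ‖toMap (u j) y l‖ ∂σ n ≤ K := by
      intro j
      have h1 : eLpNorm (fun y => toMap (u j) y l) 1 (σ n) ≤ ENNReal.ofReal K := by
        refine (eLpNorm_mono fun y => PiLp.norm_apply_le (toMap (u j) y) l).trans ?_
        exact (eLpNorm_le_eLpNorm_of_exponent_le hp1 (memLp_toMap (u j)).1).trans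
          ((eLpNorm_toMap_le _).trans (ENNReal.ofReal_le_ofReal (hK j)))
      rw [integral_norm_eq_lintegral_enorm (hi j).1, ← eLpNorm_one_eq_lintegral_enorm]
      exact ENNReal.toReal_le_of_le_ofReal hK0 h1
    rw [ENNReal.tendsto_nhds_zero]
    intro ε hε
    have hε2 : 0 < ε / 2 := ENNReal.div_pos hε.ne' (by simp)
    have hrate := ENNReal.Tendsto.mul_const (b := ENNReal.ofReal K) (tendsto_zonalRate (n := n))
      (Or.inr ENNReal.ofReal_ne_top)
    rw [zero_mul] at hrate
    -- N is fixed first, uniformly in j, thanks to the gradient bound; only afterwards j → ∞, by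
    -- dominated convergence of the averages.
    obtain ⟨N, hN⟩ := ((ENNReal.tendsto_nhds_zero.1 hrate) (ε / 2) hε2).exists
    obtain ⟨C, hC0, hC⟩ := exists_bound_zonalConv (n := n) N
    have hTc : ∀ j, Continuous fun x : S n => zonalConv N (fun y => toMap (u j) y l) x :=
      fun j => continuous_zonalConv_sphere N (hi j)
    have hT := tendsto_eLpNorm_of_dominated (μ := σ n) (r := 1) (h := fun _ => C * K) one_ne_zero
      ENNReal.one_ne_top (fun j => (hTc j).aestronglyMeasurable) (memLp_const _)
      (fun j => ae_of_all _ fun x => (hC _ (hi j) x).trans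
        (mul_le_mul_of_nonneg_left (hnorm j) hC0))
      (ae_of_all _ fun x => tendsto_zonalConv_of_weak (r := r) hu N l x)
    filter_upwards [(ENNReal.tendsto_nhds_zero.1 hT) (ε / 2) hε2] with j hj
    have hdec : (fun x => toMap (u j) x l) =
        (fun x : S n => zonalConv N (fun y => toMap (u j) y l) x) -
          fun x : S n => zonalConv N (fun y => toMap (u j) y l) x - toMap (u j) x l := by
      funext x; simp
    rw [hdec]
    refine (eLpNorm_sub_le (hTc j).aestronglyMeasurable
      ((hTc j).aestronglyMeasurable.sub (hi j).1) le_rfl).trans ?_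
    refine (add_le_add hj ((eLpNorm_zonalConv_sub_le N (integrable_toMap _)
      ((memLp_grad (u j)).integrable hp1) (isWeakGradient_grad _) l).trans ?_)).trans_eq
      (ENNReal.add_halves ε)
    exact (mul_le_mul_right (hG1 j) _).trans hN
  have hsum := tendsto_finsetSum (Finset.univ : Finset (Fin n)) fun l _ => hcoord l
  rw [Finset.sum_const_zero] at hsum
  exact tendsto_of_tendsto_of_tendsto_of_le_of_le tendsto_const_nhds hsum (fun _ => zero_le)
    fun j => eLpNorm_le_sum_coord (memLp_toMap _).1 le_rfl

end Rellich

/-! ### Componentwise arctangent truncation -/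

section Truncation

variable {n : ℕ}

/-- Multiplication of the rows of a matrix by scalars. -/
def rowMul (c : Fin n → ℝ) (M : Mat n) : Mat n := WithLp.toLp 2 fun l => c l • M l

lemma norm_rowMul_le {c : Fin n → ℝ} {C : ℝ} (hC : 0 ≤ C) (hc : ∀ l, |c l| ≤ C) (M : Mat n) :
    ‖rowMul c M‖ ≤ C * ‖M‖ := by
  refine abs_le_of_sq_le_sq' ?_ (by positivity) |>.2
  rw [mul_pow, PiLp.norm_sq_eq_of_L2, PiLp.norm_sq_eq_of_L2, Finset.mul_sum]
  refine Finset.sum_le_sum fun l _ => ?_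
  have : ‖rowMul c M l‖ = |c l| * ‖M l‖ := by simp [rowMul, norm_smul]
  rw [this, mul_pow]
  gcongr
  exact hc l

lemma rowMul_sub (c : Fin n → ℝ) (M M' : Mat n) :
    rowMul c (M - M') = rowMul c M - rowMul c M' := by
  ext l : 1
  simp [rowMul, smul_sub]

lemma rowMul_const (c : ℝ) (M : Mat n) : rowMul (fun _ => c) M = c • M := by
  ext l : 1
  simp [rowMul]

lemma continuous_rowMul : Continuous fun z : (Fin n → ℝ) × Mat n => rowMul z.1 z.2 := by
  unfold rowMul
  fun_prop

/-- The bounded truncation `δ arctan (· / δ)` of all components. -/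
def trunc (δ : ℝ) (y : E n) : E n := WithLp.toLp 2 fun l => δ * Real.arctan (y l / δ)

/-- The derivative of the truncation, componentwise. -/
def truncDeriv (δ : ℝ) (y : E n) : Fin n → ℝ := fun l => 1 / (1 + (y l / δ) ^ 2)

lemma contDiff_trunc (δ : ℝ) : ContDiff ℝ ∞ (trunc (n := n) δ) := by
  rw [contDiff_piLp]
  intro l
  refine contDiff_const.mul (Real.contDiff_arctan.comp ?_)
  exact ((EuclideanSpace.proj l : E n →L[ℝ] ℝ).contDiff).div_const _

lemma norm_trunc_le {δ : ℝ} (hδ : 0 < δ) (y : E n) : ‖trunc δ y‖ ≤ n * (2 * δ) := by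
  refine (norm_le_sum_norm _).trans ?_
  have h : ∀ l ∈ (Finset.univ : Finset (Fin n)), ‖trunc δ y l‖ ≤ 2 * δ := by
    intro l _
    have h1 := Real.arctan_lt_pi_div_two (y l / δ)
    have h2 := Real.neg_pi_div_two_lt_arctan (y l / δ)
    have h3 := Real.pi_lt_four
    have : ‖trunc δ y l‖ = δ * |Real.arctan (y l / δ)| := by
      simp [trunc, abs_of_pos hδ]
    rw [this, mul_comm]
    refine mul_le_mul_of_nonneg_right (abs_le.2 ⟨by linarith, by linarith⟩) hδ.le
  refine (Finset.sum_le_card_nsmul _ _ _ h).trans ?_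
  simp

lemma truncDeriv_pos (δ : ℝ) (y : E n) (l : Fin n) : 0 < truncDeriv δ y l := by
  unfold truncDeriv; positivity

lemma truncDeriv_le_one (δ : ℝ) (y : E n) (l : Fin n) : truncDeriv δ y l ≤ 1 := by
  unfold truncDeriv
  rw [div_le_one (by positivity)]
  linarith [sq_nonneg (y l / δ)]

lemma continuous_truncDeriv (δ : ℝ) : Continuous (truncDeriv (n := n) δ) := by
  unfold truncDeriv
  refine continuous_pi fun l => ?_
  refine Continuous.div continuous_const (by fun_prop) fun y => by positivity

lemma abs_truncDeriv_le (δ : ℝ) (y : E n) (l : Fin n) : |truncDeriv δ y l| ≤ 1 := by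
  rw [abs_of_pos (truncDeriv_pos δ y l)]; exact truncDeriv_le_one δ y l

lemma norm_rowMul_truncDeriv_le (δ : ℝ) (y : E n) (M : Mat n) :
    ‖rowMul (truncDeriv δ y) M‖ ≤ ‖M‖ := by
  simpa using norm_rowMul_le zero_le_one (abs_truncDeriv_le δ y) M

/-- Chain rule. Truncating each component separately makes the effect on the gradient diagonal in
the rows. -/
lemma tangGradMap_trunc {δ : ℝ} (hδ : δ ≠ 0) {φ : E n → E n} (hφ : ContDiff ℝ ∞ φ) (x : E n) :
    tangGradMap (fun z => trunc δ (φ z)) x = rowMul (truncDeriv δ (φ x)) (tangGradMap φ x) := by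
  ext l : 1
  have hd : DifferentiableAt ℝ (fun z => φ z l) x := by
    have : Differentiable ℝ φ := hφ.differentiable (by simp)
    fun_prop
  have hs : HasDerivAt (fun t : ℝ => δ * Real.arctan (t / δ)) (truncDeriv δ (φ x) l) (φ x l) := by
    have h1 : HasDerivAt (fun t : ℝ => t / δ) (1 / δ) (φ x l) := (hasDerivAt_id _).div_const δ
    have h2 := (h1.arctan).const_mul δ
    refine h2.congr_deriv ?_
    simp only [truncDeriv]
    field_simp
  have hF : fderiv ℝ (fun z => trunc δ (φ z) l) x =
      truncDeriv δ (φ x) l • fderiv ℝ (fun z => φ z l) x := by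
    have hc := hs.comp_hasFDerivAt x hd.hasFDerivAt
    exact hc.fderiv
  have hgrad : gradient (fun z => trunc δ (φ z) l) x =
      truncDeriv δ (φ x) l • gradient (fun z => φ z l) x := by
    rw [gradient, gradient, hF]; simp
  have e1 : tangGradMap (fun z => trunc δ (φ z)) x l = tangGrad (fun z => trunc δ (φ z) l) x := rfl
  have e2 : rowMul (truncDeriv δ (φ x)) (tangGradMap φ x) l =
      truncDeriv δ (φ x) l • tangGrad (fun z => φ z l) x := rfl
  rw [e1, e2, tangGrad, tangGrad, hgrad, real_inner_smul_left, smul_sub, smul_smul]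

end Truncation

/-! ### The tested equation and weighted monotonicity -/

section Compactness

variable {n : ℕ}

lemma holderConjugate_ofReal {p : ℝ} (hp : 2 ≤ p) :
    ENNReal.HolderConjugate (ENNReal.ofReal p.conjExponent) (ENNReal.ofReal p) :=
  (Real.HolderConjugate.conjExponent (by linarith)).symm.ennrealOfReal

/-- Testing the equation with a truncated regularization. -/
lemma abs_integral_trunc_zonalConv_le {p : ℝ} [Fact (1 ≤ ENNReal.ofReal p)] [n.AtLeastTwo]
    {v u : W n (ENNReal.ofReal p)} {f : Lp (E n) 1 (σ n)} {g : WDual n (ENNReal.ofReal p)}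
    (h : IsWeakSolution p v f g) {δ : ℝ} (hδ : 0 < δ) (N : ℕ) :
    |∫ x : S n, ⟪pFlux p (grad v x), rowMul (truncDeriv δ (zonalConvMap N (toMap u) x))
        (tangGradMap (zonalConvMap N (toMap u)) x)⟫ ∂σ n| ≤
      n * (2 * δ) * ‖f‖ + ‖g‖ * (n * (2 * δ) + (eLpNorm (fun x : S n =>
        tangGradMap (zonalConvMap N (toMap u)) x) (ENNReal.ofReal p) (σ n)).toReal) := by
  have hT := contDiff_zonalConvMap N (integrable_toMap u)
  have hφ : ContDiff ℝ ∞ (fun z => trunc δ (zonalConvMap N (toMap u) z)) :=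
    (contDiff_trunc δ).comp hT
  obtain ⟨w, hw1, hw2⟩ := exists_smooth_mem_W (ENNReal.ofReal p) hφ
  have hw := h w ⟨_, hφ, hw1⟩
  have hgw : grad w =ᵐ[σ n] fun x : S n => rowMul (truncDeriv δ (zonalConvMap N (toMap u) x))
      (tangGradMap (zonalConvMap N (toMap u)) x) := by
    filter_upwards [hw2] with x hx
    rw [hx, tangGradMap_trunc hδ.ne' hT]
  have e1 : ∫ x, ⟪‖grad v x‖ ^ (p - 2) • grad v x, grad w x⟫ ∂σ n =
      ∫ x : S n, ⟪pFlux p (grad v x), rowMul (truncDeriv δ (zonalConvMap N (toMap u) x))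
        (tangGradMap (zonalConvMap N (toMap u)) x)⟫ ∂σ n := by
    refine integral_congr_ae ?_
    filter_upwards [hgw] with x hx
    rw [hx, pFlux]
  -- The reason for truncating: f is only integrable, so the test map has to be small in the sup
  -- norm.
  have e2 : |∫ x, ⟪f x, toMap w x⟫ ∂σ n| ≤ n * (2 * δ) * ‖f‖ := by
    rw [L1.norm_eq_integral_norm, ← integral_const_mul, ← Real.norm_eq_abs]
    refine norm_integral_le_of_norm_le ((L1.integrable_coeFn f).norm.const_mul _) ?_
    filter_upwards [hw1] with x hx
    rw [hx, mul_comm]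
    exact (norm_inner_le_norm _ _).trans
      (mul_le_mul_of_nonneg_left (norm_trunc_le hδ _) (norm_nonneg _))
  have hfin : eLpNorm (fun x : S n => tangGradMap (zonalConvMap N (toMap u)) x)
      (ENNReal.ofReal p) (σ n) ≠ ⊤ :=
    (memLp_of_continuous ((continuous_tangGradMap hT).comp continuous_subtype_val) _).2.ne
  set L := (eLpNorm (fun x : S n => tangGradMap (zonalConvMap N (toMap u)) x)
    (ENNReal.ofReal p) (σ n)).toReal with hL
  have hL0 : 0 ≤ L := ENNReal.toReal_nonneg
  have hδn : 0 ≤ n * (2 * δ) := by positivity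
  have e3 : ‖w‖ ≤ n * (2 * δ) + L := by
    refine norm_le_of_eLpNorm w (by positivity) ?_ ?_
    · refine (eLpNorm_le_of_ae_bound (C := n * (2 * δ)) ?_).trans ?_
      · filter_upwards [hw1] with x hx
        rw [hx]
        exact norm_trunc_le hδ _
      · rw [measure_univ, ENNReal.one_rpow, one_mul]
        exact ENNReal.ofReal_le_ofReal (by linarith)
    · rw [eLpNorm_congr_ae hgw]
      refine (eLpNorm_mono fun x => norm_rowMul_truncDeriv_le _ _ _).trans ?_
      rw [← ENNReal.ofReal_toReal hfin]
      exact ENNReal.ofReal_le_ofReal (by linarith)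
  have e4 : |g w| ≤ ‖g‖ * (n * (2 * δ) + L) :=
    (g.le_opNorm w).trans (mul_le_mul_of_nonneg_left e3 (norm_nonneg _))
  rw [e1] at hw
  rw [abs_le] at e2 e4 ⊢
  constructor <;> linarith

/-- Testing the equation with the truncation of a Sobolev map. -/
lemma abs_integral_trunc_le {p : ℝ} (hp : 2 ≤ p) [Fact (1 ≤ ENNReal.ofReal p)] [n.AtLeastTwo]
    {v u : W n (ENNReal.ofReal p)} {f : Lp (E n) 1 (σ n)} {g : WDual n (ENNReal.ofReal p)}
    (h : IsWeakSolution p v f g) {δ : ℝ} (hδ : 0 < δ) :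
    |∫ x : S n, ⟪pFlux p (grad v x), rowMul (truncDeriv δ (toMap u x)) (grad u x)⟫ ∂σ n| ≤
      n * (2 * δ) * ‖f‖ + ‖g‖ * (n * (2 * δ) + ‖u‖) := by
  have hp1 : 1 ≤ ENNReal.ofReal p := Fact.out
  have hptop : ENNReal.ofReal p ≠ ⊤ := ENNReal.ofReal_ne_top
  have := holderConjugate_ofReal hp
  have hTi := fun N => (contDiff_zonalConvMap N (integrable_toMap u))
  have hTc : ∀ N, Continuous fun x : S n => zonalConvMap N (toMap u) x := fun N =>
    (hTi N).continuous.comp continuous_subtype_val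
  have hHc : ∀ N, Continuous fun x : S n => tangGradMap (zonalConvMap N (toMap u)) x := fun N =>
    (continuous_tangGradMap (hTi N)).comp continuous_subtype_val
  have hmeas : TendstoInMeasure (σ n) (fun N (x : S n) => zonalConvMap N (toMap u) x) atTop
      (toMap u) :=
    tendstoInMeasure_of_tendsto_eLpNorm one_ne_zero (fun N => (hTc N).aestronglyMeasurable)
      (integrable_toMap u).1 (tendsto_zonalConvMap le_rfl ENNReal.one_ne_top
        (memLp_one_iff_integrable.2 (integrable_toMap u)))
  -- The row factors depend on the values of the averages, so almost everywhere convergence is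
  -- needed, and a subsequence suffices to pass to the limit in the inequality.
  obtain ⟨ns, hns, hae⟩ := hmeas.exists_seq_tendsto_ae
  have hH := (tendsto_tangGradMap_zonalConvMap hp1 hptop (integrable_toMap u) (memLp_grad u)
    (isWeakGradient_grad u)).comp hns.tendsto_atTop
  set D : ℕ → S n → Fin n → ℝ := fun k x => truncDeriv δ (zonalConvMap (ns k) (toMap u) x) with hD
  set H : ℕ → S n → Mat n := fun k x => tangGradMap (zonalConvMap (ns k) (toMap u)) x with hHdef
  have hDc : ∀ k, Continuous (D k) := fun k => (continuous_truncDeriv δ).comp (hTc (ns k))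
  have hGm := (memLp_grad u).1
  have hum := (memLp_toMap u).1
  have hDu : AEStronglyMeasurable (fun x => rowMul (truncDeriv δ (toMap u x)) (grad u x)) (σ n) :=
    continuous_rowMul.comp_aestronglyMeasurable
      (((continuous_truncDeriv δ).comp_aestronglyMeasurable hum).prodMk hGm)
  have hDG : ∀ k, AEStronglyMeasurable (fun x => rowMul (D k x) (grad u x)) (σ n) := fun k =>
    continuous_rowMul.comp_aestronglyMeasurable ((hDc k).aestronglyMeasurable.prodMk hGm)
  have hDH : ∀ k, AEStronglyMeasurable (fun x => rowMul (D k x) (H k x)) (σ n) := fun k =>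
    continuous_rowMul.comp_aestronglyMeasurable
      ((hDc k).aestronglyMeasurable.prodMk (hHc (ns k)).aestronglyMeasurable)
  -- Replacing the gradient first costs at most its L^p error, as the factors are at most 1;
  -- replacing the factors next is dominated convergence with majorant 2|∇u|.
  have hB : Tendsto (fun k => eLpNorm (fun x => rowMul (D k x) (H k x) -
      rowMul (truncDeriv δ (toMap u x)) (grad u x)) (ENNReal.ofReal p) (σ n)) atTop (𝓝 0) := by
    have h2 : Tendsto (fun k => eLpNorm (fun x => rowMul (D k x) (grad u x) -
        rowMul (truncDeriv δ (toMap u x)) (grad u x)) (ENNReal.ofReal p) (σ n)) atTop (𝓝 0) := by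
      refine tendsto_eLpNorm_of_dominated (h := fun x => 2 * ‖grad u x‖)
        (zero_lt_one.trans_le hp1).ne' hptop (fun k => (hDG k).sub hDu)
        ((memLp_grad u).norm.const_mul 2) (fun k => ae_of_all _ fun x => ?_) ?_
      · refine (norm_sub_le _ _).trans ?_
        have a := norm_rowMul_truncDeriv_le δ (zonalConvMap (ns k) (toMap u) x) (grad u x)
        have b := norm_rowMul_truncDeriv_le δ (toMap u x) (grad u x)
        linarith
      · filter_upwards [hae] with x hx
        have h3 := ((continuous_truncDeriv δ).tendsto (toMap u x)).comp hx
        have h4 : Tendsto (fun k => rowMul (D k x) (grad u x)) atTop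
            (𝓝 (rowMul (truncDeriv δ (toMap u x)) (grad u x))) :=
          (continuous_rowMul.tendsto (truncDeriv δ (toMap u x), grad u x)).comp
            (h3.prodMk_nhds tendsto_const_nhds)
        simpa using h4.sub_const (rowMul (truncDeriv δ (toMap u x)) (grad u x))
    have h5 := hH.add h2
    rw [add_zero] at h5
    refine tendsto_of_tendsto_of_tendsto_of_le_of_le tendsto_const_nhds h5 (fun _ => zero_le)
      fun k => ?_
    have hdec : (fun x => rowMul (D k x) (H k x) -
        rowMul (truncDeriv δ (toMap u x)) (grad u x)) =
        (fun x => rowMul (D k x) (H k x) - rowMul (D k x) (grad u x)) +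
        fun x => rowMul (D k x) (grad u x) - rowMul (truncDeriv δ (toMap u x)) (grad u x) := by
      funext x; simp
    rw [hdec]
    refine (eLpNorm_add_le ((hDH k).sub (hDG k)) ((hDG k).sub hDu) hp1).trans
      (add_le_add (eLpNorm_mono fun x => ?_) le_rfl)
    rw [Pi.sub_apply, ← rowMul_sub]
    exact norm_rowMul_truncDeriv_le _ _ _
  have ha := memLp_pFlux hp (memLp_grad v)
  have hDHm : ∀ k, MemLp (fun x => rowMul (D k x) (H k x)) (ENNReal.ofReal p) (σ n) := fun k =>
    (memLp_of_continuous (hHc (ns k)) _).mono (hDH k)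
      (ae_of_all _ fun x => norm_rowMul_truncDeriv_le _ _ _)
  have hDum : MemLp (fun x => rowMul (truncDeriv δ (toMap u x)) (grad u x))
      (ENNReal.ofReal p) (σ n) :=
    (memLp_grad u).mono hDu (ae_of_all _ fun x => norm_rowMul_truncDeriv_le _ _ _)
  have hI := tendsto_integral_inner (r := ENNReal.ofReal p.conjExponent) (fun _ => ha.1)
    (fun k => (hDH k).sub hDu) ha.2.ne (fun _ => le_rfl) hB
  have hI' : Tendsto (fun k => ∫ x, ⟪pFlux p (grad v x), rowMul (D k x) (H k x)⟫ ∂σ n) atTop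
      (𝓝 (∫ x, ⟪pFlux p (grad v x), rowMul (truncDeriv δ (toMap u x)) (grad u x)⟫ ∂σ n)) := by
    have := hI.add_const
      (∫ x, ⟪pFlux p (grad v x), rowMul (truncDeriv δ (toMap u x)) (grad u x)⟫ ∂σ n)
    rw [zero_add] at this
    refine this.congr fun k => ?_
    rw [← integral_add (integrable_inner_of_memLp ha ((hDHm k).sub hDum))
      (integrable_inner_of_memLp ha hDum)]
    refine integral_congr_ae (ae_of_all _ fun x => ?_)
    simp only [Pi.sub_apply]
    rw [← inner_add_right, sub_add_cancel]
  set e : ℕ → ℝ≥0∞ := fun k => eLpNorm (fun x => H k x - grad u x) (ENNReal.ofReal p) (σ n) with he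
  have hefin : ∀ k, e k ≠ ⊤ := fun k =>
    ((memLp_of_continuous (hHc (ns k)) _).sub (memLp_grad u)).2.ne
  have helim : Tendsto (fun k => (e k).toReal) atTop (𝓝 0) := by
    rw [ENNReal.tendsto_toReal_zero_iff hefin]
    exact hH
  have hrhs : Tendsto (fun k => n * (2 * δ) * ‖f‖ + ‖g‖ * (n * (2 * δ) + ((e k).toReal + ‖u‖)))
      atTop (𝓝 (n * (2 * δ) * ‖f‖ + ‖g‖ * (n * (2 * δ) + (0 + ‖u‖)))) :=
    (((helim.add_const _).const_add _).const_mul _).const_add _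
  rw [zero_add] at hrhs
  refine le_of_tendsto_of_tendsto' hI'.abs hrhs fun k => ?_
  refine (abs_integral_trunc_zonalConv_le h hδ (ns k)).trans ?_
  have hH1 : (eLpNorm (H k) (ENNReal.ofReal p) (σ n)).toReal ≤ (e k).toReal + ‖u‖ := by
    refine ENNReal.toReal_le_of_le_ofReal (by positivity) ?_
    rw [ENNReal.ofReal_add ENNReal.toReal_nonneg (norm_nonneg _), ENNReal.ofReal_toReal (hefin k)]
    have hdec : H k = (fun x => H k x - grad u x) + grad u := by funext x; simp
    rw [hdec]
    exact (eLpNorm_add_le ((hHc (ns k)).aestronglyMeasurable.sub hGm) hGm hp1).trans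
      (add_le_add le_rfl (eLpNorm_grad_le u))
  gcongr

/-- Monotonicity needs one scalar weight, but the truncation gives a factor per row. The product of
the factors lies below each of them, and each row contributes a nonnegative term. -/
lemma prod_mul_le_inner_rowMul {p : ℝ} {c : Fin n → ℝ} (hc0 : ∀ l, 0 ≤ c l) (hc1 : ∀ l, c l ≤ 1)
    (M : Mat n) : (∏ l, c l) * ⟪pFlux p M, M⟫ ≤ ⟪pFlux p M, rowMul c M⟫ := by
  have hsum : ∀ M' : Mat n, ⟪pFlux p M, M'⟫ = ‖M‖ ^ (p - 2) * ∑ l, ⟪M l, M' l⟫ := fun M' => by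
    rw [pFlux, real_inner_smul_left, PiLp.inner_apply]
  rw [hsum, hsum]
  have h : ∀ l, (∏ k, c k) * ⟪M l, M l⟫ ≤ ⟪M l, rowMul c M l⟫ := by
    intro l
    have e : rowMul c M l = c l • M l := rfl
    rw [e, real_inner_smul_right]
    refine mul_le_mul_of_nonneg_right ?_ real_inner_self_nonneg
    rw [← Finset.mul_prod_erase _ _ (Finset.mem_univ l)]
    exact mul_le_of_le_one_right (hc0 l)
      (Finset.prod_le_one (fun k _ => hc0 k) fun k _ => hc1 k)
  rw [mul_left_comm, Finset.mul_sum]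
  exact mul_le_mul_of_nonneg_left (Finset.sum_le_sum fun l _ => h l) (by positivity)

/-- The pointwise inequality behind the strong convergence of gradients. -/
lemma weighted_monotone {p : ℝ} (hp : 2 ≤ p) {c : Fin n → ℝ} (hc0 : ∀ l, 0 ≤ c l)
    (hc1 : ∀ l, c l ≤ 1) (M M' : Mat n) :
    2 ^ (1 - p) * ((∏ l, c l) * ‖M - M'‖ ^ p) ≤
      ⟪pFlux p M, rowMul c (M - M')⟫ + ⟪pFlux p M, rowMul c M' - (∏ l, c l) • M'⟫ -
        ⟪pFlux p M', M - M'⟫ + ⟪M - M', (1 - ∏ l, c l) • pFlux p M'⟫ := by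
  have h0 : 0 ≤ ∏ l, c l := Finset.prod_nonneg fun l _ => hc0 l
  have h1 := mul_le_mul_of_nonneg_left (pFlux_monotone hp M M') h0
  have h2 := prod_mul_le_inner_rowMul (p := p) hc0 hc1 M
  -- With m the product, m⟨a, M⟩ is bounded through the rows (a the flux of M), while the remaining
  -- terms are only rearranged, writing m = 1 - (1 - m) in front of the flux of M'.
  rw [rowMul_sub, real_inner_smul_right, real_inner_comm (pFlux p M') (M - M')]
  simp only [inner_sub_left, inner_sub_right, real_inner_smul_right] at h1 ⊢
  linarith

/-- Outside a set of vanishing measure the weight is at least 1/2, and there Markov's inequality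
applies. The weights may depend on δ, as the truncations do. -/
lemma tendstoInMeasure_of_weighted {α : Type*} [MeasurableSpace α] {μ : Measure α}
    [IsFiniteMeasure μ] {V : Type*} [NormedAddCommGroup V] {H : ℕ → α → V} {p : ℝ} (hp : 0 ≤ p)
    (h : ∀ δ > 0, ∃ m : ℕ → α → ℝ, TendstoInMeasure μ m atTop (fun _ => 1) ∧
      (∀ j x, 0 ≤ m j x) ∧ (∀ j, Integrable (fun x => m j x * ‖H j x‖ ^ p) μ) ∧
      ∀ᶠ j in atTop, ∫ x, m j x * ‖H j x‖ ^ p ∂μ ≤ δ) :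
    TendstoInMeasure μ H atTop fun _ => 0 := by
  rw [tendstoInMeasure_iff_measureReal_norm]
  intro ε hε
  rw [Metric.tendsto_atTop']
  intro η hη
  have hεp : 0 < ε ^ p := by positivity
  obtain ⟨m, hm1, hm0, hmi, hm⟩ := h (ε ^ p / 2 * (η / 3)) (by positivity)
  rw [tendstoInMeasure_iff_measureReal_norm] at hm1
  have hsmall := (hm1 (1 / 2) (by norm_num)).eventually (gt_mem_nhds (show 0 < η / 3 by positivity))
  obtain ⟨J, hJ⟩ := eventually_atTop.1 (hm.and hsmall)
  refine ⟨J, fun j hj => ?_⟩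
  obtain ⟨hj1, hj2⟩ := hJ j hj.le
  rw [Real.dist_eq, sub_zero, abs_of_nonneg measureReal_nonneg]
  have hsub : {x | ε ≤ ‖H j x - 0‖} ⊆ {x | 1 / 2 ≤ ‖m j x - 1‖} ∪
      {x | ε ^ p / 2 ≤ m j x * ‖H j x‖ ^ p} := by
    intro x hx
    by_cases hxm : 1 / 2 ≤ ‖m j x - 1‖
    · exact Or.inl hxm
    · right
      have hx' : ε ≤ ‖H j x‖ := by simpa using hx
      have h1 : 1 / 2 ≤ m j x := by
        rw [Real.norm_eq_abs, not_le, abs_lt] at hxm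
        linarith
      have h2 : ε ^ p ≤ ‖H j x‖ ^ p := Real.rpow_le_rpow hε.le hx' hp
      calc ε ^ p / 2 = 1 / 2 * ε ^ p := by ring
        _ ≤ _ := mul_le_mul h1 h2 hεp.le (hm0 j x)
  have hmarkov := mul_meas_ge_le_integral_of_nonneg
    (ae_of_all _ fun x => mul_nonneg (hm0 j x) (by positivity)) (hmi j) (ε ^ p / 2)
  have h3 : μ.real {x | ε ^ p / 2 ≤ m j x * ‖H j x‖ ^ p} ≤ η / 3 := by
    have := hmarkov.trans hj1
    exact le_of_mul_le_mul_left this (by positivity)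
  have := (measureReal_mono (μ := μ) hsub).trans (measureReal_union_le _ _)
  linarith

end Compactness

/-! ### Convergence in measure of the gradients -/

section StrongConvergence

variable {n : ℕ}

lemma tendsto_truncDeriv_one (δ : ℝ) {y : ℕ → E n} (hy : Tendsto y atTop (𝓝 0)) :
    Tendsto (fun j => truncDeriv δ (y j)) atTop (𝓝 fun _ => 1) := by
  have h := ((continuous_truncDeriv (n := n) δ).tendsto 0).comp hy
  have h0 : truncDeriv δ (0 : E n) = fun _ => 1 := by funext l; simp [truncDeriv]
  rwa [h0] at h

lemma prod_truncDeriv_nonneg (δ : ℝ) (y : E n) : 0 ≤ ∏ l, truncDeriv δ y l :=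
  Finset.prod_nonneg fun l _ => (truncDeriv_pos δ y l).le

lemma prod_truncDeriv_le_one (δ : ℝ) (y : E n) : ∏ l, truncDeriv δ y l ≤ 1 :=
  Finset.prod_le_one (fun l _ => (truncDeriv_pos δ y l).le) fun l _ => truncDeriv_le_one δ y l

lemma continuous_prod_truncDeriv (δ : ℝ) :
    Continuous fun y : E n => ∏ l, truncDeriv δ y l :=
  continuous_finsetProd _ fun l _ => (continuous_apply l).comp (continuous_truncDeriv δ)

lemma tendsto_prod_truncDeriv_one (δ : ℝ) {y : ℕ → E n} (hy : Tendsto y atTop (𝓝 0)) :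
    Tendsto (fun j => ∏ l, truncDeriv δ (y j) l) atTop (𝓝 1) := by
  have h := ((continuous_prod_truncDeriv (n := n) δ).tendsto 0).comp hy
  have h0 : ∏ l, truncDeriv δ (0 : E n) l = 1 := by simp [truncDeriv]
  rwa [h0] at h

lemma tendsto_norm_dual_mul {p : ℝ≥0∞} [Fact (1 ≤ p)] {g : ℕ → WDual n p}
    (hg : Tendsto g atTop (𝓝 0)) (C : ℝ) : Tendsto (fun j => ‖g j‖ * C) atTop (𝓝 0) := by
  have h : Tendsto (fun j => ‖g j‖) atTop (𝓝 0) :=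
    ((continuous_norm (E := WDual n p)).tendsto' 0 0 (norm_zero (E := WDual n p))).comp hg
  simpa using h.mul_const C

lemma integral_trunc_le_of_bound {p : ℝ} (hp : 2 ≤ p) [Fact (1 ≤ ENNReal.ofReal p)]
    [n.AtLeastTwo] {v u : W n (ENNReal.ofReal p)} {f : Lp (E n) 1 (σ n)}
    {g : WDual n (ENNReal.ofReal p)} (h : IsWeakSolution p v f g) {δ : ℝ} (hδ : 0 < δ)
    {K L : ℝ} (hf : ‖f‖ ≤ K) (hu : ‖u‖ ≤ L) :
    ∫ x : S n, ⟪pFlux p (grad v x), rowMul (truncDeriv δ (toMap u x)) (grad u x)⟫ ∂σ n ≤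
      n * (2 * δ) * K + ‖g‖ * (n * (2 * δ) + L) := by
  refine (le_abs_self _).trans ((abs_integral_trunc_le hp h hδ).trans ?_)
  gcongr

set_option maxHeartbeats 1000000 in
/-- If the solutions converge almost everywhere, their gradients converge in measure. -/
lemma tendstoInMeasure_grad [n.AtLeastTwo] {p : ℝ} (hp : 2 ≤ p) [Fact (1 ≤ ENNReal.ofReal p)]
    {v : ℕ → W n (ENNReal.ofReal p)} {f : ℕ → Lp (E n) 1 (σ n)}
    {g : ℕ → WDual n (ENNReal.ofReal p)} {v_lim : W n (ENNReal.ofReal p)}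
    (hsol : ∀ j, IsWeakSolution p (v j) (f j) (g j))
    {K : ℝ} (hK : ∀ j, ‖v j‖ ≤ K ∧ ‖f j‖ ≤ K)
    (hg : Tendsto g atTop (𝓝 0))
    (hv : ∀ ℓ : WDual n (ENNReal.ofReal p), Tendsto (fun j => ℓ (v j)) atTop (𝓝 (ℓ v_lim)))
    (hae : ∀ᵐ x ∂σ n, Tendsto (fun j => toMap (v j - v_lim) x) atTop (𝓝 0)) :
    TendstoInMeasure (σ n) (fun j => grad (v j - v_lim)) atTop fun _ => 0 := by
  have hp1 : 1 ≤ ENNReal.ofReal p := Fact.out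
  have hptop : ENNReal.ofReal p ≠ ⊤ := ENNReal.ofReal_ne_top
  have hconj := holderConjugate_ofReal hp
  have hconj' : ENNReal.HolderConjugate (ENNReal.ofReal p) (ENNReal.ofReal p.conjExponent) :=
    hconj.symm
  have hr1 : 1 ≤ ENNReal.ofReal p.conjExponent := by
    rw [ENNReal.one_le_ofReal, Real.conjExponent, one_le_div (by linarith)]
    linarith
  have : Fact (1 ≤ ENNReal.ofReal p.conjExponent) := ⟨hr1⟩
  have hK0 : 0 ≤ K := (norm_nonneg _).trans (hK 0).1
  set K' : ℝ := K + ‖v_lim‖ with hK'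
  have huK : ∀ j, ‖v j - v_lim‖ ≤ K' := fun j =>
    (norm_sub_le _ _).trans (by linarith [(hK j).1])
  refine tendstoInMeasure_of_weighted (p := p) (by linarith) fun δ₀ hδ₀ => ?_
  set κ : ℝ := 2 ^ (1 - p) with hκ
  have hκ0 : 0 < κ := by positivity
  -- Makes the contribution 2nδK of f_j at most κδ₀/2; the summand 1 keeps the denominator positive
  -- when K = 0.
  set δ : ℝ := κ * δ₀ / (2 * (2 * n * K + 1)) with hδdef
  have hden : 0 < 2 * (2 * n * K + 1) := by positivity
  have hδ : 0 < δ := by positivity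
  have hδle : n * (2 * δ) * K ≤ κ * δ₀ / 2 := by
    have h1 : δ * (2 * (2 * n * K + 1)) = κ * δ₀ := div_mul_cancel₀ _ hden.ne'
    nlinarith
  set u : ℕ → W n (ENNReal.ofReal p) := fun j => v j - v_lim with hu
  set c : ℕ → S n → Fin n → ℝ := fun j x => truncDeriv δ (toMap (u j) x) with hc
  set m : ℕ → S n → ℝ := fun j x => ∏ l, c j x l with hm
  have hG := memLp_grad v_lim
  have hflux := memLp_pFlux hp hG
  have hum : ∀ j, AEStronglyMeasurable (toMap (u j)) (σ n) := fun j => (memLp_toMap _).1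
  have hcm : ∀ j, AEStronglyMeasurable (c j) (σ n) := fun j =>
    (continuous_truncDeriv δ).comp_aestronglyMeasurable (hum j)
  have hmm : ∀ j, AEStronglyMeasurable (m j) (σ n) := fun j =>
    (continuous_prod_truncDeriv δ).comp_aestronglyMeasurable (hum j)
  have hm0 : ∀ j x, 0 ≤ m j x := fun j x => prod_truncDeriv_nonneg δ _
  have hm1 : ∀ j x, m j x ≤ 1 := fun j x => prod_truncDeriv_le_one δ _
  -- the four terms of the pointwise inequality
  set B₁ : ℕ → S n → Mat n := fun j x => rowMul (c j x) (grad (u j) x) with hB₁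
  set B₂ : ℕ → S n → Mat n := fun j x =>
    rowMul (c j x) (grad v_lim x) - m j x • grad v_lim x with hB₂
  set B₄ : ℕ → S n → Mat n := fun j x => (1 - m j x) • pFlux p (grad v_lim x) with hB₄
  have hB₁m : ∀ j, MemLp (B₁ j) (ENNReal.ofReal p) (σ n) := fun j =>
    (memLp_grad (u j)).mono
      (continuous_rowMul.comp_aestronglyMeasurable ((hcm j).prodMk (memLp_grad (u j)).1))
      (ae_of_all _ fun x => norm_rowMul_truncDeriv_le _ _ _)
  have hB₂a : ∀ j, AEStronglyMeasurable (B₂ j) (σ n) := fun j =>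
    (continuous_rowMul.comp_aestronglyMeasurable ((hcm j).prodMk hG.1)).sub ((hmm j).smul hG.1)
  have hB₂le : ∀ j x, ‖B₂ j x‖ ≤ 2 * ‖grad v_lim x‖ := fun j x => by
    refine (norm_sub_le _ _).trans ?_
    have h1 := norm_rowMul_truncDeriv_le δ (toMap (u j) x) (grad v_lim x)
    have h2 : ‖m j x • grad v_lim x‖ ≤ ‖grad v_lim x‖ := by
      rw [norm_smul, Real.norm_of_nonneg (hm0 j x)]
      exact mul_le_of_le_one_left (norm_nonneg _) (hm1 j x)
    linarith
  have hB₂m : ∀ j, MemLp (B₂ j) (ENNReal.ofReal p) (σ n) := fun j =>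
    MemLp.of_le_mul hG (hB₂a j) (ae_of_all _ (hB₂le j))
  have hB₄a : ∀ j, AEStronglyMeasurable (B₄ j) (σ n) := fun j =>
    (aestronglyMeasurable_const.sub (hmm j)).smul hflux.1
  have hB₄le : ∀ j x, ‖B₄ j x‖ ≤ ‖pFlux p (grad v_lim x)‖ := fun j x => by
    rw [hB₄, norm_smul, Real.norm_of_nonneg (by linarith [hm1 j x])]
    exact mul_le_of_le_one_left (norm_nonneg _) (by linarith [hm0 j x])
  have hB₄m : ∀ j, MemLp (B₄ j) (ENNReal.ofReal p.conjExponent) (σ n) := fun j =>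
    hflux.mono (hB₄a j) (ae_of_all _ (hB₄le j))
  have i₁ := fun j => integrable_inner_of_memLp (memLp_pFlux hp (memLp_grad (v j))) (hB₁m j)
  have i₂ := fun j => integrable_inner_of_memLp (memLp_pFlux hp (memLp_grad (v j))) (hB₂m j)
  have i₃ := fun j => integrable_inner_of_memLp hflux (memLp_grad (u j))
  have i₄ := fun j => integrable_inner_of_memLp (memLp_grad (u j)) (hB₄m j)
  have hpt : ∀ j, ∀ᵐ x ∂σ n, κ * (m j x * ‖grad (u j) x‖ ^ p) ≤
      ⟪pFlux p (grad (v j) x), B₁ j x⟫ + ⟪pFlux p (grad (v j) x), B₂ j x⟫ -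
        ⟪pFlux p (grad v_lim x), grad (u j) x⟫ + ⟪grad (u j) x, B₄ j x⟫ := by
    intro j
    filter_upwards [grad_sub (v j) v_lim] with x hx
    have hx' : grad (u j) x = grad (v j) x - grad v_lim x := hx
    have := weighted_monotone hp (fun l => (truncDeriv_pos δ (toMap (u j) x) l).le)
      (truncDeriv_le_one δ (toMap (u j) x)) (grad (v j) x) (grad v_lim x)
    rw [← hx'] at this
    exact this
  have hint := fun j => (((i₁ j).add (i₂ j)).sub (i₃ j)).add (i₄ j)
  have hκm : ∀ j, Integrable (fun x => κ * (m j x * ‖grad (u j) x‖ ^ p)) (σ n) := by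
    intro j
    refine (hint j).mono' ?_ ?_
    · exact (((hmm j).mul ((memLp_grad (u j)).1.norm.aemeasurable.pow_const
        p).aestronglyMeasurable)).const_mul κ
    · filter_upwards [hpt j] with x hx
      rw [Real.norm_of_nonneg (mul_nonneg hκ0.le (mul_nonneg (hm0 j x) (by positivity)))]
      exact hx
  have hle : ∀ j, κ * ∫ x, m j x * ‖grad (u j) x‖ ^ p ∂σ n ≤
      ∫ x, ⟪pFlux p (grad (v j) x), B₁ j x⟫ ∂σ n + ∫ x, ⟪pFlux p (grad (v j) x), B₂ j x⟫ ∂σ n -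
        ∫ x, ⟪pFlux p (grad v_lim x), grad (u j) x⟫ ∂σ n + ∫ x, ⟪grad (u j) x, B₄ j x⟫ ∂σ n := by
    intro j
    rw [← integral_const_mul]
    refine (integral_mono_ae (hκm j) (hint j) (hpt j)).trans_eq ?_
    rw [integral_add' (((i₁ j).add (i₂ j)).sub (i₃ j)) (i₄ j),
      integral_sub' ((i₁ j).add (i₂ j)) (i₃ j), integral_add' (i₁ j) (i₂ j)]
  -- The flux of v_j is merely bounded in L^{p'}, so B₂ has to vanish strongly: its row factors and
  -- its scalar weight both tend to 1.
  have l₂ : Tendsto (fun j => ∫ x, ⟪pFlux p (grad (v j) x), B₂ j x⟫ ∂σ n) atTop (𝓝 0) := by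
    refine tendsto_integral_inner (r := ENNReal.ofReal p.conjExponent) (s := ENNReal.ofReal p)
      (K := ENNReal.ofReal K ^ (p - 1))
      (fun j => (memLp_pFlux hp (memLp_grad (v j))).1) hB₂a
      (ENNReal.rpow_ne_top_of_nonneg (by linarith) ENNReal.ofReal_ne_top) (fun j => ?_) ?_
    · rw [eLpNorm_pFlux hp]
      exact ENNReal.rpow_le_rpow ((eLpNorm_grad_le _).trans
        (ENNReal.ofReal_le_ofReal (hK j).1)) (by linarith)
    · refine tendsto_eLpNorm_of_dominated (zero_lt_one.trans_le hp1).ne' hptop hB₂a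
        (hG.norm.const_mul 2) (fun j => ae_of_all _ (hB₂le j)) ?_
      filter_upwards [hae] with x hx
      have h1 : Tendsto (fun j => rowMul (c j x) (grad v_lim x)) atTop
          (𝓝 (rowMul (fun _ => 1) (grad v_lim x))) :=
        (continuous_rowMul.tendsto ((fun _ => 1), grad v_lim x)).comp
          ((tendsto_truncDeriv_one δ hx).prodMk_nhds tendsto_const_nhds)
      have h2 := h1.sub ((tendsto_prod_truncDeriv_one δ hx).smul_const (grad v_lim x))
      rwa [rowMul_const, sub_self] at h2
  -- The flux of the limit is a fixed L^{p'} field, so weak convergence of v_j is all that is used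
  -- here.
  have l₃ : Tendsto (fun j => ∫ x, ⟪pFlux p (grad v_lim x), grad (u j) x⟫ ∂σ n) atTop (𝓝 0) := by
    obtain ⟨ℓ, hℓ⟩ := exists_dual_grad (p := ENNReal.ofReal p) hflux
    have h := (hv ℓ).sub_const (ℓ v_lim)
    rw [sub_self] at h
    refine h.congr fun j => ?_
    rw [← hℓ, ← map_sub]
  have l₄ : Tendsto (fun j => ∫ x, ⟪grad (u j) x, B₄ j x⟫ ∂σ n) atTop (𝓝 0) := by
    refine tendsto_integral_inner (r := ENNReal.ofReal p) (s := ENNReal.ofReal p.conjExponent)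
      (K := ENNReal.ofReal K') (fun j => (memLp_grad (u j)).1) hB₄a ENNReal.ofReal_ne_top
      (fun j => (eLpNorm_grad_le _).trans (ENNReal.ofReal_le_ofReal (huK j))) ?_
    refine tendsto_eLpNorm_of_dominated (zero_lt_one.trans_le hr1).ne' ENNReal.ofReal_ne_top hB₄a
      hflux.norm (fun j => ae_of_all _ (hB₄le j)) ?_
    filter_upwards [hae] with x hx
    have h := ((tendsto_prod_truncDeriv_one δ hx).const_sub 1).smul_const (pFlux p (grad v_lim x))
    rwa [sub_self, zero_smul] at h
  -- Only the g-part of the tested term vanishes as j → ∞; the f-part does not and is absorbed by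
  -- the choice of δ.
  have l₁ := tendsto_norm_dual_mul hg (n * (2 * δ) + K')
  have hsum := ((l₁.add l₂).sub l₃).add l₄
  simp only [add_zero, sub_zero] at hsum
  refine ⟨m, ?_, hm0, fun j => ?_, ?_⟩
  · refine tendstoInMeasure_of_tendsto_ae hmm ?_
    filter_upwards [hae] with x hx
    exact tendsto_prod_truncDeriv_one δ hx
  · have := (hκm j).const_mul κ⁻¹
    refine this.congr (ae_of_all _ fun x => ?_)
    simp only
    rw [inv_mul_cancel_left₀ hκ0.ne']
  · filter_upwards [hsum.eventually (gt_mem_nhds (show 0 < κ * δ₀ / 2 by positivity))] with j hj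
    have h1 := integral_trunc_le_of_bound hp (hsol j) (u := u j) hδ (hK j).2 (huK j)
    have h4 := hle j
    refine le_of_mul_le_mul_left ?_ hκ0
    linarith

end StrongConvergence

end SphereSobolev

end

/-! ### The compactness theorem -/

open SphereSobolev in
theorem proposition4p1 (n : ℕ) (hn : 3 ≤ n) (p : ℝ) (hp : 2 ≤ p) [Fact (1 ≤ ENNReal.ofReal p)]
    (v : ℕ → W n (ENNReal.ofReal p)) (f : ℕ → Lp (E n) 1 (σ n))
    (g : ℕ → WDual n (ENNReal.ofReal p)) (v_lim : W n (ENNReal.ofReal p))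
    (hsol : ∀ j, IsWeakSolution p (v j) (f j) (g j))
    (hK : ∃ K : ℝ, ∀ j, ‖v j‖ ≤ K ∧ ‖f j‖ ≤ K)
    (hg : Tendsto g atTop (𝓝 0))
    (hv : ∀ ℓ : WDual n (ENNReal.ofReal p), Tendsto (fun j => ℓ (v j)) atTop (𝓝 (ℓ v_lim)))
    (q : ℝ) (hq1 : 1 ≤ q) (hqp : q < p) :
    Tendsto (fun j =>
        eLpNorm (fun x => toMap (v j) x - toMap v_lim x) (ENNReal.ofReal q) (σ n) +
        eLpNorm (fun x => grad (v j) x - grad v_lim x) (ENNReal.ofReal q) (σ n))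
      atTop (𝓝 0) := by
  have : n.AtLeastTwo := ⟨by omega⟩
  obtain ⟨K, hK⟩ := hK
  have hconj := holderConjugate_ofReal hp
  have : Fact (1 ≤ ENNReal.ofReal p.conjExponent) := ⟨by
    rw [ENNReal.one_le_ofReal, Real.conjExponent, one_le_div (by linarith)]
    linarith⟩
  have huK : ∀ j, ‖v j - v_lim‖ ≤ K + ‖v_lim‖ := fun j =>
    (norm_sub_le _ _).trans (by linarith [(hK j).1])
  have huw : ∀ ℓ : WDual n (ENNReal.ofReal p),
      Tendsto (fun j => ℓ (v j - v_lim)) atTop (𝓝 0) := fun ℓ => by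
    have h := (hv ℓ).sub_const (ℓ v_lim)
    rw [sub_self] at h
    exact h.congr fun j => (map_sub ℓ _ _).symm
  have hL1 := tendsto_eLpNorm_one_of_weak (r := ENNReal.ofReal p.conjExponent) huK huw
  have hmeas : TendstoInMeasure (σ n) (fun j => toMap (v j - v_lim)) atTop fun _ => 0 := by
    refine tendstoInMeasure_of_tendsto_eLpNorm one_ne_zero (fun j => (memLp_toMap _).1)
      aestronglyMeasurable_const ?_
    refine hL1.congr fun j => eLpNorm_congr_ae (ae_of_all _ fun x => ?_)
    simp
  have hmap : Tendsto (fun j => eLpNorm (toMap (v j - v_lim)) (ENNReal.ofReal q) (σ n))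
      atTop (𝓝 0) :=
    tendsto_eLpNorm_of_tendstoInMeasure hq1 hqp (fun j => Lp.stronglyMeasurable _)
      ENNReal.ofReal_ne_top
      (fun j => (eLpNorm_toMap_le _).trans (ENNReal.ofReal_le_ofReal (huK j))) hmeas
  have hgrad : Tendsto (fun j => eLpNorm (grad (v j - v_lim)) (ENNReal.ofReal q) (σ n))
      atTop (𝓝 0) := by
    -- The gradient argument needs almost everywhere convergence of the maps, which convergence in
    -- measure provides only along subsequences; every subsequence having a further one with limit 0
    -- is enough.
    refine tendsto_of_subseq_tendsto fun ns hns => ?_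
    have hsub : TendstoInMeasure (σ n) (fun k => toMap (v (ns k) - v_lim)) atTop fun _ => 0 :=
      fun ε hε => (hmeas ε hε).comp hns
    obtain ⟨ms, hms, hae⟩ := hsub.exists_seq_tendsto_ae
    have hnm : Tendsto (fun k => ns (ms k)) atTop atTop := hns.comp hms.tendsto_atTop
    refine ⟨ms, tendsto_eLpNorm_of_tendstoInMeasure hq1 hqp (fun j => Lp.stronglyMeasurable _)
      ENNReal.ofReal_ne_top
      (fun j => (eLpNorm_grad_le _).trans (ENNReal.ofReal_le_ofReal (huK _))) ?_⟩
    exact tendstoInMeasure_grad hp (fun k => hsol (ns (ms k))) (fun k => hK (ns (ms k)))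
      (hg.comp hnm) (fun ℓ => (hv ℓ).comp hnm) hae
  have hsum := hmap.add hgrad
  rw [add_zero] at hsum
  refine hsum.congr fun j => ?_
  rw [eLpNorm_congr_ae (toMap_sub (v j) v_lim), eLpNorm_congr_ae (grad_sub (v j) v_lim)]
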